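/- Let $n\ge 1$ and let a single additive buyer have valuations $x_1,\dots,x_n$, independent and uniform on $[0,1]$. A price schedule $p=\{p_I\}_{I\subseteq[n]}$ of real numbers with $p_\emptyset=0$ defines a deterministic auction: the buyer with valuation $x$ receives a bundle $I$ maximizing $\sum_{i\in I}x_i-p_I$ and pays $p_I$. Let $D_I\subseteq[0,1]^n$ be the set of valuations for which $I$ attains this maximum. The expected revenue is $\mathrm{Rev}(p)=\sum_I p_I\,\mathrm{vol}_n D_I$. The schedule is symmetric if $p_I$ depends only on $|I|$, submodular if $p_{I\cup J}+p_{I\cap J}\le p_I+p_J$ for all $I,J$, and normalized if $p_I=\min\{p_J: J\supsetneq I\}$ for every $I\ne[n]$ with $\mathrm{vol}_n D_I=0$. An auction is optimal if its price schedule is symmetric and submodular and maximizes $\mathrm{Rev}$ among all symmetric submodular price schedules. Write $\pi_K$ for the projection to the coordinates in $K$ and $$\delta_n(I)=\mathrm{vol}_{|I|}\,\pi_I(D_I)-\frac1{n+1}\sum_{i\in I}\mathrm{vol}_{|I|-1}\,\pi_{I\setminus\{i\}}(D_I).$$ If $I\not\subseteq J$, $J\not\subseteq I$ and $p_{I\cup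 J}+p_{I\cap J}=p_I+p_J$, then $I\cup J$ and $I\cap J$ are called left tight and $I$ and $J$ right tight; $p$ is degenerate if such $I,J$ exist. The critical conditions are, for all nonempty $I$: (1) if $I$ is neither left nor right tight and $\mathrm{vol}_nD_I>0$, then $\delta_n(I)=0$; (2) if $I$ is neither left nor right tight and $\mathrm{vol}_nD_I=0$, then $\delta_n(I)\ge0$; (3) if $I$ is left but not right tight, then $\delta_n(I)\ge0$; (4) if $I$ is right but not left tight and $\mathrm{vol}_nD_I>0$, then $\delta_n(I)\le0$. Let $\mathcal I_{k,n}$ consist of $[n]$ and all bundles with at most $k$ items. A schedule is critical with respect to $\mathcal I_{k,n}$ if $\mathrm{vol}_nD_I>0$ holds exactly for $I\in\mathcal I_{k,n}$, and $\delta_n(I)=0$ for all nonempty $I\in\mathcal I_{k,n}$. The straight-jacket auction (SJA) is given by a normalized symmetric submodular price schedule that is critical with respect to $\mathcal I_{k,n}$, where $k\in\{1,\dots,n\}$ is the largest number for which such a schedule exists. Then the following hold. (a) There is an optimal auction with a normalized price schedule. (b) Every optimal auction with a normalized price schedule satisfies the critical conditions, and it is the SJA or degenerate. (c) Every SJA price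 schedule $p$ is optimal, unless there is a normalized, degenerate, optimal price schedule $q$ that satisfies the critical conditions and has $\mathrm{Rev}(q)>\mathrm{Rev}(p)$. (d) In particular, if no degenerate, normalized, symmetric, submodular price schedule other than the SJA satisfies the critical conditions, then the SJA exists and is optimal among all deterministic, submodular and symmetric auctions. -/

import Mathlib

open MeasureTheory

namespace Auction

/-- A price schedule for `n` items assigns a price to every bundle `I ⊆ [n]`; the requirement
`p ∅ = 0` is the first clause of `IsSymmSubmodular`. -/
abbrev Prices (n : ℕ) : Type := Finset (Fin n) → ℝ

variable {n : ℕ}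

/-- The region `D_I`: the valuations in the unit cube for which the bundle `I` maximizes the
utility `∑_{i ∈ I} x_i - p_I` of the buyer. -/
def region (p : Prices n) (I : Finset (Fin n)) : Set (Fin n → ℝ) :=
  {x | (∀ i, 0 ≤ x i ∧ x i ≤ 1) ∧ ∀ J, ∑ j ∈ J, x j - p J ≤ ∑ i ∈ I, x i - p I}

/-- The coordinate projection `π_K (D_I)` in `ℝ^K`. -/
def projRegion (p : Prices n) (I K : Finset (Fin n)) : Set (K → ℝ) :=
  (fun x (k : K) => x k) '' region p I

/-- The expected revenue for independent valuations that are uniform on `[0, 1]`. -/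
noncomputable def revenue (p : Prices n) : ℝ :=
  ∑ I, p I * volume.real (region p I)

/-- The deficiency
`δ_n(I) = vol_{|I|} π_I(D_I) - 1/(n+1) ∑_{i ∈ I} vol_{|I|-1} π_{I \ {i}}(D_I)`.
The volume on `ℝ^∅` is the unit mass of the point. -/
noncomputable def deficiency (p : Prices n) (I : Finset (Fin n)) : ℝ :=
  volume.real (projRegion p I I)
    - 1 / ((n : ℝ) + 1) * ∑ i ∈ I, volume.real (projRegion p I (I.erase i))

def IsSubmodular (p : Prices n) : Prop :=
  ∀ I J, p (I ∪ J) + p (I ∩ J) ≤ p I + p J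

def IsSymmetric (p : Prices n) : Prop :=
  ∀ I J : Finset (Fin n), I.card = J.card → p I = p J

/-- `p` is a symmetric and submodular price schedule. -/
def IsSymmSubmodular (p : Prices n) : Prop :=
  p ∅ = 0 ∧ IsSubmodular p ∧ IsSymmetric p

/-- Bundles that are not sold get the smallest price of a strictly larger bundle. There is no
larger bundle than `[n]`, so nothing is required of its price. -/
def IsNormalized (p : Prices n) : Prop :=
  ∀ I, I ≠ Finset.univ → volume (region p I) = 0 → IsLeast {c | ∃ J, I ⊂ J ∧ p J = c} (p I)

/-- The submodularity inequality of `I` and `J` holds with equality. Comparable bundles always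
give equality, so that only incomparable ones count. -/
def IsTightPair (p : Prices n) (I J : Finset (Fin n)) : Prop :=
  ¬ I ⊆ J ∧ ¬ J ⊆ I ∧ p (I ∪ J) + p (I ∩ J) = p I + p J

def IsLeftTight (p : Prices n) (K : Finset (Fin n)) : Prop :=
  ∃ I J, IsTightPair p I J ∧ (K = I ∪ J ∨ K = I ∩ J)

def IsRightTight (p : Prices n) (K : Finset (Fin n)) : Prop :=
  ∃ J, IsTightPair p K J

/-- At least one submodularity condition is satisfied with equality. -/
def IsDegenerate (p : Prices n) : Prop :=
  ∃ I J, IsTightPair p I J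

/-- The four necessary critical point conditions. The price of the empty bundle is fixed, so there
is no condition for it. -/
def SatisfiesCriticalConditions (p : Prices n) : Prop :=
  ∀ I : Finset (Fin n), I.Nonempty →
    (¬ IsLeftTight p I → ¬ IsRightTight p I → 0 < volume (region p I) → deficiency p I = 0) ∧
    (¬ IsLeftTight p I → ¬ IsRightTight p I → volume (region p I) = 0 → 0 ≤ deficiency p I) ∧
    (IsLeftTight p I → ¬ IsRightTight p I → 0 ≤ deficiency p I) ∧
    (IsRightTight p I → ¬ IsLeftTight p I → 0 < volume (region p I) → deficiency p I ≤ 0)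

/-- The selling candidate `𝓘_{k,n}`: the bundles with at most `k` items, and `[n]`. -/
def candidate (n k : ℕ) : Set (Finset (Fin n)) :=
  {I | I.card ≤ k ∨ I = Finset.univ}

/-- `p` is critical with respect to the family `S` of bundles: the bundles that are sold with
positive probability are those of `S`, and the deficiency of the nonempty ones vanishes. -/
def IsCriticalFor (p : Prices n) (S : Set (Finset (Fin n))) : Prop :=
  (∀ I, 0 < volume (region p I) ↔ I ∈ S) ∧ ∀ I ∈ S, I.Nonempty → deficiency p I = 0

/-- `p` is the (normalized) price schedule of the straight-jacket auction for `n` items: it is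
critical with respect to `𝓘_{k,n}`, where `k ∈ {1, …, n}` is maximal such that a symmetric,
submodular, critical price schedule exists for `𝓘_{k,n}`. -/
def IsSJA (p : Prices n) : Prop :=
  IsSymmSubmodular p ∧ IsNormalized p ∧
    ∃ k, IsGreatest {l : ℕ | 1 ≤ l ∧ l ≤ n ∧ ∃ q : Prices n,
        IsSymmSubmodular q ∧ IsNormalized q ∧ IsCriticalFor q (candidate n l)} k ∧
      IsCriticalFor p (candidate n k)

/-- `p` is a symmetric submodular price schedule of maximal expected revenue among all symmetric
submodular price schedules, normalized or not. -/
def IsOptimal (p : Prices n) : Prop :=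
  IsSymmSubmodular p ∧ ∀ q : Prices n, IsSymmSubmodular q → revenue q ≤ revenue p

end Auction

/-!
A symmetric schedule is a sequence `P 0 = 0, P 1, …, P n` of prices, indexed by the size of the
bundle, and it is submodular if and only if this sequence is concave. For a submodular schedule the
region of a bundle `I` is a product of an upper part in the coordinates in `I` and a lower part in
the other ones (`optSet_eq_inter`), so that its projections are sections of the upper part, and all
volumes are probabilities under the uniform distribution on the cube. The volume of the section
`x_i = 1` of a set is the probability that the valuation is in the set after `x_i` has been replaced
by `1`.

**First variation.** With `u` the utility of the buyer, the divergence theorem gives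
`Rev = ∑_i ∫_{x_i = 1} u - (n + 1) ∫ u` (`revenue_eq_integral_util`). Hence revenue depends
continuously on the prices, and when the price of the `k`-bundles is lowered it changes at the rate
`∑_i vol (D ∩ {x_i = 1}) - (n + 1) vol D`, where `D` is the union of the regions of these bundles
(`revenue_lowerPrice_sub`). By the product structure, this is a negative multiple of the deficiency
(`lowerRate_eq`). The factor is the volume of the lower parts, which may vanish at the schedule
itself but is positive as soon as the price has been lowered. So an optimal schedule has nonnegative
deficiency where the price may be lowered, that is, at bundles that are not right tight
(`cubeDeficiency_nonneg`), and nonpositive deficiency where it may be raised, at sold bundles that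
are not left tight (`cubeDeficiency_nonpos`). These are the critical conditions.

**Existence.** Prices may be assumed to lie in `[0, n]`, so an optimal schedule exists by
compactness. Cutting all prices off at `P n` does not change the revenue. An optimal schedule has
`P 1 < 1` (`lt_one_of_isOptimal`): otherwise, with `r` maximal such that `P r ≥ r`, it is better to
lower the price of the `r`-bundles slightly below `r`, since the upper part is then thin, so that
its volume is negligible compared to its faces. A nondecreasing schedule with `P 1 < 1` is
normalized, because a bundle with `k < n` items is not sold only if `P k = P (k + 1)`.

**Uniqueness.** The regions for a buyer who only wants items of `S` fill the cube and each of its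
faces `x_i = 1`, `i ∈ S`. Summing over them (`sum_cubeDeficiency`), the vanishing of the
deficiencies becomes the statement that such a buyer takes nothing with probability
`1 - |S| / (n + 1)`. This probability is strictly increasing in the price of `S`
(`noSale_lt_noSale`), so that it determines the prices one after the other (`IsCriticalSeq.eq`), and
there is at most one SJA (`IsSJA.unique`).

**Nondegenerate optima.** If no submodularity inequality is tight, then `P` is strictly concave, and
all bundles are sold, except possibly those with `n - 1` items. The latter happens only if there is
no schedule that is critical with respect to all bundles, by comparing the probabilities of no sale;
for `n = 2`, it does not happen at all (`noSale_two_lt`). In either case the schedule is the SJA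
(`isSJA_of_not_isDegenerate`).
-/

namespace Auction

variable {n : ℕ}

/-! ### The uniform distribution on the cube -/

/-- The uniform distribution on the unit cube, as a product measure. -/
noncomputable def unif (n : ℕ) : Measure (Fin n → ℝ) :=
  Measure.pi fun _ => volume.restrict (Set.Icc (0 : ℝ) 1)

/-- The unit cube `[0, 1]^n`. -/
def cube (n : ℕ) : Set (Fin n → ℝ) := Set.univ.pi fun _ => Set.Icc 0 1

lemma mem_cube {x : Fin n → ℝ} : x ∈ cube n ↔ ∀ i, 0 ≤ x i ∧ x i ≤ 1 := by
  simp only [cube, Set.mem_pi, Set.mem_univ, true_implies, Set.mem_Icc]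

instance isProbabilityMeasure_restrict_Icc :
    IsProbabilityMeasure (volume.restrict (Set.Icc (0 : ℝ) 1)) := ⟨by simp⟩

instance isProbabilityMeasure_unif : IsProbabilityMeasure (unif n) := by
  unfold unif; infer_instance

lemma unif_eq_restrict : unif n = volume.restrict (cube n) := by
  rw [unif, ← Measure.restrict_pi_pi]; rfl

lemma measurableSet_cube : MeasurableSet (cube n) :=
  MeasurableSet.univ_pi fun _ => measurableSet_Icc

lemma unif_apply {A : Set (Fin n → ℝ)} : unif n A = volume (A ∩ cube n) := by
  rw [unif_eq_restrict, Measure.restrict_apply' measurableSet_cube]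

lemma unif_real_apply {A : Set (Fin n → ℝ)} :
    (unif n).real A = volume.real (A ∩ cube n) := by
  simp [Measure.real, unif_apply]

lemma ae_mem_cube : ∀ᵐ x ∂unif n, x ∈ cube n := by
  rw [unif_eq_restrict]
  exact ae_restrict_mem measurableSet_cube

lemma unif_real_congr {A B : Set (Fin n → ℝ)} (h : ∀ x ∈ cube n, x ∈ A ↔ x ∈ B) :
    (unif n).real A = (unif n).real B := by
  rw [unif_real_apply, unif_real_apply]
  congr 1
  ext x
  simp only [Set.mem_inter_iff]
  exact ⟨fun hx => ⟨(h x hx.2).1 hx.1, hx.2⟩, fun hx => ⟨(h x hx.2).2 hx.1, hx.2⟩⟩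

lemma unif_real_mono {A B : Set (Fin n → ℝ)} (h : A ⊆ B) :
    (unif n).real A ≤ (unif n).real B := measureReal_mono h

/-- Resampling one coordinate does not change the uniform distribution. -/
lemma measurePreserving_update (i : Fin n) :
    MeasurePreserving (fun q : (Fin n → ℝ) × ℝ => Function.update q.1 i q.2)
      ((unif n).prod (volume.restrict (Set.Icc 0 1))) (unif n) := by
  have hm : Measurable (fun q : (Fin n → ℝ) × ℝ => Function.update q.1 i q.2) := by
    refine measurable_pi_lambda _ fun j => ?_
    by_cases hj : j = i
    · subst hj; simpa using measurable_snd
    · simp only [Function.update_of_ne hj]; fun_prop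
  refine ⟨hm, ?_⟩
  symm
  refine Measure.pi_eq fun s hs => ?_
  rw [Measure.map_apply hm (MeasurableSet.univ_pi hs)]
  have : (fun q : (Fin n → ℝ) × ℝ => Function.update q.1 i q.2) ⁻¹' Set.univ.pi s
      = (Set.univ.pi (Function.update s i Set.univ)) ×ˢ s i := by
    ext q
    simp only [Set.mem_preimage, Set.mem_pi, Set.mem_univ, true_implies, Set.mem_prod]
    constructor
    · intro h
      refine ⟨fun j => ?_, by simpa using h i⟩
      by_cases hj : j = i
      · subst hj; simp
      · simpa [hj] using h j
    · rintro ⟨h, h'⟩ j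
      by_cases hj : j = i
      · subst hj; simpa using h'
      · simpa [hj] using h j
  rw [this, Measure.prod_prod, unif, Measure.pi_pi,
    ← Finset.prod_erase_mul _ _ (Finset.mem_univ i),
    ← Finset.prod_erase_mul (a := i) Finset.univ (fun j => volume.restrict (Set.Icc 0 1) (s j))
      (Finset.mem_univ i)]
  have h1 : (volume.restrict (Set.Icc (0 : ℝ) 1)) Set.univ = 1 := measure_univ
  simp only [Function.update_self, h1, mul_one]
  congr 1
  refine Finset.prod_congr rfl fun j hj => ?_
  rw [Function.update_of_ne (Finset.ne_of_mem_erase hj)]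

lemma measurable_update_one (i : Fin n) (t : ℝ) :
    Measurable (fun x : Fin n → ℝ => Function.update x i t) := by fun_prop

/-- Events that depend on disjoint sets of coordinates are independent. -/
lemma unif_real_inter (I : Finset (Fin n)) {A B : Set (Fin n → ℝ)} (hA : MeasurableSet A)
    (hB : MeasurableSet B) (hAI : ∀ x y, (∀ i ∈ I, x i = y i) → x ∈ A → y ∈ A)
    (hBI : ∀ x y, (∀ i ∉ I, x i = y i) → x ∈ B → y ∈ B) :
    (unif n).real (A ∩ B) = (unif n).real A * (unif n).real B := by
  let ext (S : Finset (Fin n)) (y : S → ℝ) (i : Fin n) : ℝ := if h : i ∈ S then y ⟨i, h⟩ else 0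
  have hext : ∀ S, Measurable (ext S) := by
    intro S
    refine measurable_pi_lambda _ fun i => ?_
    by_cases h : i ∈ S
    · simp only [ext, h, dite_true]; fun_prop
    · simp only [ext, h, dite_false]; fun_prop
  have hind := (ProbabilityTheory.iIndepFun_pi (μ := fun _ : Fin n => volume.restrict
    (Set.Icc (0 : ℝ) 1)) (X := fun _ => id) (fun _ => aemeasurable_id)).indepFun_finset I Iᶜ
    disjoint_compl_right (fun i => measurable_pi_apply i)
  have h := hind.measure_inter_preimage_eq_mul (ext I ⁻¹' A) (ext Iᶜ ⁻¹' B) (hext I hA) (hext Iᶜ hB)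
  have eA : (fun (a : Fin n → ℝ) (i : I) => id (a i)) ⁻¹' (ext I ⁻¹' A) = A := by
    ext x
    constructor
    · exact fun hx => hAI _ _ (fun i hi => by simp [ext, hi]) hx
    · exact fun hx => hAI x _ (fun i hi => by simp [ext, hi]) hx
  have eB : (fun (a : Fin n → ℝ) (i : (Iᶜ : Finset (Fin n))) => id (a i)) ⁻¹' (ext Iᶜ ⁻¹' B)
      = B := by
    ext x
    constructor
    · exact fun hx => hBI _ _ (fun i hi => by simp [ext, hi]) hx
    · exact fun hx => hBI x _ (fun i hi => by simp [ext, hi]) hx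
  rw [eA, eB] at h
  simp only [Measure.real, unif]
  rw [h, ENNReal.toReal_mul]

lemma unif_hyperplane {a : Fin n → ℝ} (ha : a ≠ 0) (c : ℝ) :
    unif n {x | ∑ i, a i * x i = c} = 0 := by
  obtain ⟨i, hi⟩ := Function.ne_iff.1 ha
  let f : (Fin n → ℝ) →ₗ[ℝ] ℝ := ∑ i, a i • LinearMap.proj i
  have hf : ∀ x, f x = ∑ i, a i * x i := fun x => by simp [f]
  have hset : {x | ∑ i, a i * x i = c}
      = (((AffineSubspace.mk' c (⊥ : Submodule ℝ ℝ)).comap f.toAffineMap : AffineSubspace ℝ _) :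
        Set (Fin n → ℝ)) := by
    ext x
    simp [AffineSubspace.mem_mk', hf, sub_eq_zero]
  rw [unif_apply]
  refine measure_mono_null Set.inter_subset_left ?_
  rw [hset]
  refine Measure.addHaar_affineSubspace _ _ fun htop => ?_
  have h1 : ∀ x : Fin n → ℝ, ∑ i, a i * x i = c := fun x => by
    have : x ∈ {x | ∑ i, a i * x i = c} := by rw [hset, htop]; trivial
    exact this
  have h2 := h1 0
  have h3 := h1 (Pi.single i 1)
  simp [Pi.single_apply] at h2 h3
  exact hi (by simp [h3, ← h2])

/-- An open set with a point inside the cube has positive probability. -/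
lemma unif_pos_of_isOpen {U : Set (Fin n → ℝ)} (hU : IsOpen U) {x : Fin n → ℝ} (hx : x ∈ U)
    (h01 : ∀ i, 0 < x i ∧ x i < 1) : 0 < (unif n).real U := by
  have hV : IsOpen (U ∩ Set.univ.pi fun _ : Fin n => Set.Ioo (0 : ℝ) 1) :=
    hU.inter (isOpen_set_pi Set.finite_univ fun _ _ => isOpen_Ioo)
  have h := hV.measure_pos volume ⟨x, hx, by simpa using h01⟩
  have h2 : volume (U ∩ Set.univ.pi fun _ : Fin n => Set.Ioo (0 : ℝ) 1) ≤ unif n U := by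
    rw [unif_apply]
    exact measure_mono (Set.inter_subset_inter_right _
      (Set.pi_mono fun _ _ => Set.Ioo_subset_Icc_self))
  exact ENNReal.toReal_pos (h.trans_le h2).ne' (measure_ne_top _ _)

lemma measurePreserving_perm (e : Equiv.Perm (Fin n)) :
    MeasurePreserving (fun x : Fin n → ℝ => fun i => x (e i)) (unif n) (unif n) := by
  have hm : Measurable (fun x : Fin n → ℝ => fun i => x (e i)) := by fun_prop
  refine ⟨hm, ?_⟩
  symm
  refine Measure.pi_eq fun s hs => ?_
  rw [Measure.map_apply hm (MeasurableSet.univ_pi hs)]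
  have : (fun x : Fin n → ℝ => fun i => x (e i)) ⁻¹' Set.univ.pi s
      = Set.univ.pi (fun i => s (e.symm i)) := by
    ext x
    simp only [Set.mem_preimage, Set.mem_pi, Set.mem_univ, true_implies]
    exact ⟨fun h i => by simpa using h (e.symm i), fun h i => by simpa using h (e i)⟩
  rw [this, unif, Measure.pi_pi]
  exact Equiv.prod_comp e.symm (fun i => volume.restrict (Set.Icc 0 1) (s i))

/-- The uniform distribution on `[0, 1]^K` is the marginal of the one on `[0, 1]^n`. -/
lemma volume_real_eq_unif_real (K : Finset (Fin n)) {S : Set (K → ℝ)} (hS : MeasurableSet S)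
    (h01 : ∀ y ∈ S, ∀ k, 0 ≤ y k ∧ y k ≤ 1) :
    volume.real S = (unif n).real {x | (fun k : K => x k) ∈ S} := by
  have hm : Measurable (fun (x : Fin n → ℝ) (k : K) => x k) := by fun_prop
  have hmap : Measure.map (fun (x : Fin n → ℝ) (k : K) => x k) (unif n)
      = Measure.pi fun _ => volume.restrict (Set.Icc (0 : ℝ) 1) := by
    symm
    refine Measure.pi_eq fun s hs => ?_
    rw [Measure.map_apply hm (MeasurableSet.univ_pi hs)]
    have : (fun (x : Fin n → ℝ) (k : K) => x k) ⁻¹' Set.univ.pi s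
        = Set.univ.pi (fun i => if h : i ∈ K then s ⟨i, h⟩ else Set.univ) := by
      ext x
      simp only [Set.mem_preimage, Set.mem_pi, Set.mem_univ, true_implies]
      constructor
      · intro h i
        by_cases hi : i ∈ K
        · simpa [hi] using h ⟨i, hi⟩
        · simp [hi]
      · intro h k
        simpa using h k
    rw [this, unif, Measure.pi_pi]
    have h1 : (volume.restrict (Set.Icc (0 : ℝ) 1)) Set.univ = 1 := measure_univ
    rw [← Finset.prod_subset (Finset.subset_univ K)
      (fun i _ hi => by simp [hi]), ← Finset.prod_coe_sort]
    refine Finset.prod_congr rfl fun k _ => by simp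
  have h2 : (unif n).real {x | (fun k : K => x k) ∈ S}
      = (Measure.map (fun (x : Fin n → ℝ) (k : K) => x k) (unif n)).real S := by
    rw [map_measureReal_apply hm hS]; rfl
  rw [h2, hmap, ← Measure.restrict_pi_pi]
  rw [Measure.real, Measure.real, Measure.restrict_apply hS]
  congr 2
  refine (Set.inter_eq_left.2 fun y hy => ?_).symm
  exact fun k _ => h01 y hy k

/-! ### Regions as products -/

/-- The valuations in `ℝ^n`, not only in the cube, for which `I` is a best choice among the
subsets of `S`. -/
def optSet (p : Prices n) (S I : Finset (Fin n)) : Set (Fin n → ℝ) :=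
  {x | ∀ J ⊆ S, ∑ j ∈ J, x j - p J ≤ ∑ i ∈ I, x i - p I}

/-- The valuations for which no subset of `I` is preferred to `I`. -/
def upperPart (p : Prices n) (I : Finset (Fin n)) : Set (Fin n → ℝ) :=
  {x | ∀ J ⊆ I, p I - p J ≤ ∑ i ∈ I \ J, x i}

/-- The valuations for which no `I ∪ K` with `I ∪ K ⊆ S` is preferred to `I`. -/
def lowerPart (p : Prices n) (S I : Finset (Fin n)) : Set (Fin n → ℝ) :=
  {x | ∀ K ⊆ S \ I, ∑ i ∈ K, x i ≤ p (I ∪ K) - p I}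

/-- The deficiency of `I` computed in the cube: for schedules that do not decrease above `I` it
is `deficiency p I`. -/
noncomputable def cubeDeficiency (p : Prices n) (I : Finset (Fin n)) : ℝ :=
  (unif n).real (upperPart p I) - 1 / ((n : ℝ) + 1) *
    ∑ i ∈ I, (unif n).real {x | Function.update x i 1 ∈ upperPart p I}

lemma isClosed_optSet (p : Prices n) (S I : Finset (Fin n)) : IsClosed (optSet p S I) := by
  simp only [optSet, Set.ofPred_forall]
  exact isClosed_iInter fun J => isClosed_iInter fun _ => isClosed_le (by fun_prop) (by fun_prop)

lemma isClosed_upperPart (p : Prices n) (I : Finset (Fin n)) : IsClosed (upperPart p I) := by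
  simp only [upperPart, Set.ofPred_forall]
  exact isClosed_iInter fun J => isClosed_iInter fun _ => isClosed_le (by fun_prop) (by fun_prop)

lemma isClosed_lowerPart (p : Prices n) (S I : Finset (Fin n)) : IsClosed (lowerPart p S I) := by
  simp only [lowerPart, Set.ofPred_forall]
  exact isClosed_iInter fun J => isClosed_iInter fun _ => isClosed_le (by fun_prop) (by fun_prop)

lemma region_eq (p : Prices n) (I : Finset (Fin n)) :
    region p I = optSet p Finset.univ I ∩ cube n := by
  ext x
  simp only [region, Set.mem_ofPred_eq, optSet, Set.mem_inter_iff, mem_cube, Finset.subset_univ,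
    true_implies]
  exact and_comm

lemma volume_real_region (p : Prices n) (I : Finset (Fin n)) :
    volume.real (region p I) = (unif n).real (optSet p Finset.univ I) := by
  rw [region_eq, unif_real_apply]

lemma volume_region (p : Prices n) (I : Finset (Fin n)) :
    volume (region p I) = unif n (optSet p Finset.univ I) := by
  rw [region_eq, unif_apply]

lemma volume_region_pos_iff (p : Prices n) (I : Finset (Fin n)) :
    0 < volume (region p I) ↔ 0 < (unif n).real (optSet p Finset.univ I) := by
  rw [volume_region, Measure.real, ENNReal.toReal_pos_iff]
  exact ⟨fun h => ⟨h, measure_lt_top _ _⟩, fun h => h.1⟩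

lemma volume_region_eq_zero_iff (p : Prices n) (I : Finset (Fin n)) :
    volume (region p I) = 0 ↔ (unif n).real (optSet p Finset.univ I) = 0 := by
  rw [volume_region, measureReal_eq_zero_iff]

lemma upperPart_mono {p : Prices n} {I : Finset (Fin n)} {x y : Fin n → ℝ}
    (h : ∀ i ∈ I, x i ≤ y i) (hx : x ∈ upperPart p I) : y ∈ upperPart p I := fun J hJ =>
  (hx J hJ).trans (Finset.sum_le_sum fun i hi => h i (Finset.mem_sdiff.1 hi).1)

lemma lowerPart_congr {p : Prices n} {S I : Finset (Fin n)} {x y : Fin n → ℝ}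
    (h : ∀ i ∉ I, x i = y i) (hx : x ∈ lowerPart p S I) : y ∈ lowerPart p S I := fun K hK => by
  rw [← Finset.sum_congr rfl fun i hi => h i (Finset.mem_sdiff.1 (hK hi)).2]
  exact hx K hK

/-- By submodularity, only the bundles comparable to `I` matter for the optimality of `I`. -/
lemma optSet_eq_inter {p : Prices n} (hp : IsSubmodular p) {S I : Finset (Fin n)} (hI : I ⊆ S) :
    optSet p S I = upperPart p I ∩ lowerPart p S I := by
  ext x
  constructor
  · intro h
    refine ⟨fun J hJ => ?_, fun K hK => ?_⟩
    · have := h J (hJ.trans hI)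
      rw [← Finset.sum_sdiff hJ] at this
      linarith
    · have := h (I ∪ K) (Finset.union_subset hI (hK.trans Finset.sdiff_subset))
      rw [Finset.sum_union (Finset.disjoint_of_subset_right hK Finset.disjoint_sdiff)] at this
      linarith
  · rintro ⟨h1, h2⟩ J hJ
    have h3 := h1 (I ∩ J) Finset.inter_subset_left
    have h4 := h2 (J \ I) (Finset.sdiff_subset_sdiff hJ le_rfl)
    rw [Finset.union_sdiff_self_eq_union] at h4
    have h5 := hp I J
    have e1 := Finset.sum_inter_add_sum_sdiff I J x
    have e2 := Finset.sum_inter_add_sum_sdiff J I x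
    rw [Finset.inter_comm] at e2
    rw [Finset.sdiff_inter_self_left] at h3
    linarith

lemma unif_real_optSet {p : Prices n} (hp : IsSubmodular p) {S I : Finset (Fin n)} (hI : I ⊆ S) :
    (unif n).real (optSet p S I)
      = (unif n).real (upperPart p I) * (unif n).real (lowerPart p S I) := by
  rw [optSet_eq_inter hp hI]
  refine unif_real_inter I (isClosed_upperPart p I).measurableSet
    (isClosed_lowerPart p S I).measurableSet (fun x y h => ?_) fun x y h => ?_
  · exact upperPart_mono fun i hi => (h i hi).le
  · exact lowerPart_congr h

lemma unif_real_update_optSet {p : Prices n} (hp : IsSubmodular p) {S I : Finset (Fin n)}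
    (hI : I ⊆ S) {i : Fin n} (hi : i ∈ I) :
    (unif n).real {x | Function.update x i 1 ∈ optSet p S I}
      = (unif n).real {x | Function.update x i 1 ∈ upperPart p I}
        * (unif n).real (lowerPart p S I) := by
  have : {x | Function.update x i 1 ∈ optSet p S I}
      = {x | Function.update x i 1 ∈ upperPart p I} ∩ lowerPart p S I := by
    ext x
    rw [optSet_eq_inter hp hI]
    have hne : ∀ j ∉ I, j ≠ i := fun j hj h => hj (h ▸ hi)
    refine and_congr_right fun _ => ⟨fun h => ?_, fun h => ?_⟩
    · exact lowerPart_congr (fun j hj => by rw [Function.update_of_ne (hne j hj)]) h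
    · exact lowerPart_congr (fun j hj => by rw [Function.update_of_ne (hne j hj)]) h
  rw [this]
  refine unif_real_inter I
    (measurable_update_one i 1 (isClosed_upperPart p I).measurableSet)
    (isClosed_lowerPart p S I).measurableSet (fun x y h => ?_) fun x y h => ?_
  · refine upperPart_mono fun j hj => ?_
    by_cases hji : j = i
    · subst hji; simp
    · simp [hji, h j hj]
  · exact lowerPart_congr h

lemma unif_tie {I J : Finset (Fin n)} (h : I ≠ J) (c : ℝ) :
    unif n {x | ∑ i ∈ I, x i - ∑ i ∈ J, x i = c} = 0 := by
  have ha : (fun i => (if i ∈ I then 1 else 0) - (if i ∈ J then 1 else 0) : Fin n → ℝ) ≠ 0 := by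
    intro h0
    apply h
    ext i
    have := congrFun h0 i
    by_cases h1 : i ∈ I <;> by_cases h2 : i ∈ J <;> simp [h1, h2] at this ⊢
  have := unif_hyperplane ha c
  simpa [sub_mul, Finset.sum_sub_distrib, Finset.sum_ite_mem] using this

/-- Up to a null set, the best choice is unique. -/
lemma unif_real_biUnion_optSet (p : Prices n) {S : Finset (Fin n)}
    (F : Finset (Finset (Fin n))) (hF : ∀ I ∈ F, I ⊆ S) :
    (unif n).real (⋃ I ∈ F, optSet p S I) = ∑ I ∈ F, (unif n).real (optSet p S I) := by
  refine measureReal_biUnion_finset₀ (fun I hI J hJ hIJ => ?_)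
    (fun I _ => (isClosed_optSet p S I).measurableSet.nullMeasurableSet)
  refine measure_mono_null (fun x hx => ?_) (unif_tie hIJ (p I - p J))
  have h1 := hx.1 J (hF J hJ)
  have h2 := hx.2 I (hF I hI)
  simp only [Set.mem_ofPred_eq]
  linarith

lemma sum_update_of_mem {I : Finset (Fin n)} {i : Fin n} (hi : i ∈ I) (x : Fin n → ℝ) (t : ℝ) :
    ∑ j ∈ I, Function.update x i t j = t + ∑ j ∈ I.erase i, x j := by
  rw [← Finset.add_sum_erase _ _ hi, Function.update_self]
  congr 1
  exact Finset.sum_congr rfl fun j hj => Function.update_of_ne (Finset.ne_of_mem_erase hj) _ _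

lemma sum_update_of_notMem {I : Finset (Fin n)} {i : Fin n} (hi : i ∉ I) (x : Fin n → ℝ)
    (t : ℝ) : ∑ j ∈ I, Function.update x i t j = ∑ j ∈ I, x j :=
  Finset.sum_congr rfl fun _ hj => Function.update_of_ne (ne_of_mem_of_not_mem hj hi) _ _

lemma unif_real_biUnion_update_optSet (p : Prices n) {S : Finset (Fin n)} {i : Fin n}
    (F : Finset (Finset (Fin n))) (hF : ∀ I ∈ F, I ⊆ S) (hi : ∀ I ∈ F, i ∈ I) :
    (unif n).real (⋃ I ∈ F, {x | Function.update x i 1 ∈ optSet p S I})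
      = ∑ I ∈ F, (unif n).real {x | Function.update x i 1 ∈ optSet p S I} := by
  refine measureReal_biUnion_finset₀ (fun I hI J hJ hIJ => ?_) (fun I _ =>
    (measurable_update_one i 1 (isClosed_optSet p S I).measurableSet).nullMeasurableSet)
  have hne : I.erase i ≠ J.erase i := fun h => hIJ <| by
    rw [← Finset.insert_erase (hi I hI), h, Finset.insert_erase (hi J hJ)]
  refine measure_mono_null (fun x hx => ?_) (unif_tie hne (p I - p J))
  have h1 := hx.1 J (hF J hJ)
  have h2 := hx.2 I (hF I hI)
  rw [sum_update_of_mem (hi I hI), sum_update_of_mem (hi J hJ)] at h1 h2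
  simp only [Set.mem_ofPred_eq]
  linarith

lemma volume_real_projRegion {p : Prices n} (hp : IsSubmodular p) {I K : Finset (Fin n)}
    (hK : K ⊆ I) (hmono : ∀ J, I ⊆ J → p I ≤ p J) :
    volume.real (projRegion p I K)
      = (unif n).real {x | (fun i => if i ∈ K then x i else 1) ∈ upperPart p I} := by
  have hc : IsCompact (region p I) := by
    rw [region_eq]
    exact (isCompact_univ_pi fun _ => isCompact_Icc).inter_left (isClosed_optSet p _ I)
  have hm : MeasurableSet (projRegion p I K) := (hc.image (by fun_prop)).measurableSet
  rw [volume_real_eq_unif_real K hm]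
  · refine unif_real_congr fun x hx => ?_
    rw [mem_cube] at hx
    simp only [Set.mem_ofPred_eq, projRegion, Set.mem_image]
    constructor
    · rintro ⟨y, hy, hyx⟩
      rw [region_eq, optSet_eq_inter hp (Finset.subset_univ I)] at hy
      refine upperPart_mono (fun i _ => ?_) hy.1.1
      by_cases hi : i ∈ K
      · simp only [hi, if_true]
        exact (congrFun hyx ⟨i, hi⟩).le
      · simpa [hi] using (mem_cube.1 hy.2 i).2
    · intro h
      refine ⟨fun i => if i ∈ K then x i else if i ∈ I then 1 else 0, ?_, by ext k; simp⟩
      have hK' : ∀ i ∉ I, i ∉ K := fun i hi h => hi (hK h)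
      rw [region_eq, optSet_eq_inter hp (Finset.subset_univ I)]
      refine ⟨⟨upperPart_mono (fun i hi => ?_) h, fun L hL => ?_⟩, mem_cube.2 fun i => ?_⟩
      · simp [hi]
      · rw [Finset.sum_eq_zero fun i hi => ?_]
        · linarith [hmono (I ∪ L) Finset.subset_union_left]
        · have hiI := (Finset.mem_sdiff.1 (hL hi)).2
          simp [hiI, hK' i hiI]
      · by_cases h1 : i ∈ K
        · simpa [h1] using hx i
        · by_cases h2 : i ∈ I <;> simp [h1, h2]
  · rintro _ ⟨y, hy, rfl⟩ k
    exact hy.1 k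

/-- The projections of a region are sections of its upper part, because regions are products. -/
lemma deficiency_eq_cubeDeficiency {p : Prices n} (hp : IsSubmodular p) {I : Finset (Fin n)}
    (hmono : ∀ J, I ⊆ J → p I ≤ p J) : deficiency p I = cubeDeficiency p I := by
  rw [deficiency, cubeDeficiency, volume_real_projRegion hp le_rfl hmono]
  congr 1
  · congr 1
    ext x
    exact ⟨upperPart_mono fun i hi => by simp [hi], upperPart_mono fun i hi => by simp [hi]⟩
  · congr 1
    refine Finset.sum_congr rfl fun i hi => ?_
    rw [volume_real_projRegion hp (Finset.erase_subset i I) hmono]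
    congr 1
    ext x
    have h : ∀ j ∈ I, (if j ∈ I.erase i then x j else 1) = Function.update x i 1 j := by
      intro j hj
      by_cases hji : j = i
      · subst hji; simp
      · simp [hji, hj]
    exact ⟨upperPart_mono fun j hj => (h j hj).le, upperPart_mono fun j hj => (h j hj).ge⟩

/-! ### Revenue as an integral of the utility -/

/-- The utility of the buyer: the maximum of `∑_{j ∈ J} x_j - p_J` over all bundles `J`. -/
noncomputable def util (p : Prices n) (x : Fin n → ℝ) : ℝ :=
  Finset.univ.sup' Finset.univ_nonempty fun J : Finset (Fin n) => ∑ j ∈ J, x j - p J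

lemma le_util (p : Prices n) (x : Fin n → ℝ) (J : Finset (Fin n)) :
    ∑ j ∈ J, x j - p J ≤ util p x :=
  Finset.le_sup' (fun J : Finset (Fin n) => ∑ j ∈ J, x j - p J) (Finset.mem_univ J)

lemma util_le {p : Prices n} {x : Fin n → ℝ} {c : ℝ} (h : ∀ J, ∑ j ∈ J, x j - p J ≤ c) :
    util p x ≤ c :=
  Finset.sup'_le _ _ fun J _ => h J

lemma exists_eq_util (p : Prices n) (x : Fin n → ℝ) : ∃ J, util p x = ∑ j ∈ J, x j - p J := by
  obtain ⟨J, -, h⟩ := Finset.exists_mem_eq_sup' Finset.univ_nonempty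
    (fun J : Finset (Fin n) => ∑ j ∈ J, x j - p J)
  exact ⟨J, h⟩

lemma mem_optSet_univ_iff {p : Prices n} {I : Finset (Fin n)} {x : Fin n → ℝ} :
    x ∈ optSet p Finset.univ I ↔ util p x = ∑ i ∈ I, x i - p I := by
  constructor
  · exact fun h => le_antisymm (util_le fun J => h J (Finset.subset_univ J)) (le_util p x I)
  · exact fun h J _ => h ▸ le_util p x J

lemma continuous_util : Continuous fun q : Prices n × (Fin n → ℝ) => util q.1 q.2 := by
  unfold util
  refine Continuous.finset_sup'_apply _ fun J _ => ?_
  fun_prop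

lemma continuous_util_right (p : Prices n) : Continuous (util p) :=
  continuous_util.comp (by fun_prop : Continuous fun x : Fin n → ℝ => (p, x))

lemma isCompact_cube : IsCompact (cube n) := isCompact_univ_pi fun _ => isCompact_Icc

lemma integrable_unif_of_continuous {f : (Fin n → ℝ) → ℝ} (hf : Continuous f) :
    Integrable f (unif n) := by
  rw [unif_eq_restrict]
  exact hf.continuousOn.integrableOn_compact isCompact_cube

lemma integrable_util (p : Prices n) : Integrable (util p) (unif n) :=
  integrable_unif_of_continuous (continuous_util_right p)

lemma integrable_util_update (p : Prices n) (i : Fin n) :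
    Integrable (fun x => util p (Function.update x i 1)) (unif n) :=
  integrable_unif_of_continuous ((continuous_util_right p).comp (by fun_prop))

/-- Integration by parts for `u t = max a (b + t)`, whose derivative is the indicator of
`a ≤ b + t`. -/
lemma integral_max_add_indicator (a b : ℝ) :
    ∫ t in Set.Icc (0 : ℝ) 1, ((if a ≤ b + t then t else 0) + max a (b + t)) = max a (b + 1) := by
  have hint : IntervalIntegrable (fun t => (if a ≤ b + t then t else 0) + max a (b + t))
      volume 0 1 := by
    have h1 : IntervalIntegrable (fun t => max a (b + t)) volume 0 1 :=
      (by fun_prop : Continuous fun t => max a (b + t)).intervalIntegrable _ _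
    refine IntervalIntegrable.add ?_ h1
    rw [intervalIntegrable_iff]
    have h2 : IntegrableOn (fun t : ℝ => t) (Set.uIoc 0 1) :=
      (intervalIntegrable_iff.1 (continuous_id.intervalIntegrable 0 1))
    exact h2.indicator (measurableSet_le measurable_const (by fun_prop) :
      MeasurableSet {t : ℝ | a ≤ b + t})
  rw [integral_Icc_eq_integral_Ioc, ← intervalIntegral.integral_of_le zero_le_one,
    integral_eq_of_hasDerivAt_off_countable (fun t => t * max a (b + t)) _
      (Set.countable_singleton (a - b)) (by fun_prop) _ hint]
  · simp
  · rintro t ⟨-, ht⟩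
    rcases lt_or_gt_of_ne (show t ≠ a - b from ht) with h | h
    · have he : (fun t => t * max a (b + t)) =ᶠ[nhds t] fun t => t * a := by
        filter_upwards [Iio_mem_nhds h] with s hs
        rw [max_eq_left]
        rw [Set.mem_Iio] at hs; linarith
      have h1 : ¬ a ≤ b + t := by linarith
      rw [if_neg h1, max_eq_left (by linarith)]
      refine HasDerivAt.congr_of_eventuallyEq ?_ he
      simpa using (hasDerivAt_id t).mul_const a
    · have he : (fun t => t * max a (b + t)) =ᶠ[nhds t] fun t => t * (b + t) := by
        filter_upwards [Ioi_mem_nhds h] with s hs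
        rw [max_eq_right]
        rw [Set.mem_Ioi] at hs; linarith
      rw [if_pos (by linarith), max_eq_right (by linarith)]
      refine HasDerivAt.congr_of_eventuallyEq ?_ he
      exact ((hasDerivAt_id' t).mul ((hasDerivAt_id' t).const_add b)).congr_deriv (by ring)

/-- Along a line in direction `i`, the utility is the maximum of a constant and of a function of
slope one, and bundles with `i` are optimal where the latter is the larger one. -/
lemma exists_util_update_eq_max (p : Prices n) (i : Fin n) (x : Fin n → ℝ) :
    ∃ a b, ∀ t, util p (Function.update x i t) = max a (b + t) ∧
      ((∃ I, i ∈ I ∧ Function.update x i t ∈ optSet p Finset.univ I) ↔ a ≤ b + t) := by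
  obtain ⟨J₀, h₀, hJ₀⟩ := Finset.exists_max_image (Finset.univ.filter fun J => i ∉ J)
    (fun J => ∑ j ∈ J, x j - p J) ⟨∅, by simp⟩
  obtain ⟨J₁, h₁, hJ₁⟩ := Finset.exists_max_image (Finset.univ.filter fun J => i ∈ J)
    (fun J => ∑ j ∈ J.erase i, x j - p J) ⟨Finset.univ, by simp⟩
  simp only [Finset.mem_filter, Finset.mem_univ, true_and] at h₀ hJ₀ h₁ hJ₁
  refine ⟨∑ j ∈ J₀, x j - p J₀, ∑ j ∈ J₁.erase i, x j - p J₁, fun t => ?_⟩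
  have e0 : ∀ J, i ∉ J → ∑ j ∈ J, Function.update x i t j = ∑ j ∈ J, x j :=
    fun J hJ => sum_update_of_notMem hJ x t
  have e1 : ∀ J, i ∈ J → ∑ j ∈ J, Function.update x i t j = t + ∑ j ∈ J.erase i, x j :=
    fun J hJ => sum_update_of_mem hJ x t
  have hmax : util p (Function.update x i t)
      = max (∑ j ∈ J₀, x j - p J₀) (∑ j ∈ J₁.erase i, x j - p J₁ + t) := by
    refine le_antisymm (util_le fun J => ?_) (max_le ?_ ?_)
    · by_cases hJ : i ∈ J
      · rw [e1 J hJ]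
        exact le_max_of_le_right (by linarith [hJ₁ J hJ])
      · rw [e0 J hJ]
        exact le_max_of_le_left (hJ₀ J hJ)
    · rw [← e0 J₀ h₀]
      exact le_util p _ J₀
    · have := le_util p (Function.update x i t) J₁
      rw [e1 J₁ h₁] at this
      linarith
  refine ⟨hmax, ⟨?_, fun h => ⟨J₁, h₁, ?_⟩⟩⟩
  · rintro ⟨I, hI, hmem⟩
    have h2 := hmem J₀ (Finset.subset_univ _)
    rw [e0 J₀ h₀, e1 I hI] at h2
    linarith [hJ₁ I hI]
  · rw [mem_optSet_univ_iff, hmax, max_eq_right h, e1 J₁ h₁]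
    ring

/-- The valuations for which some bundle with item `i` is a best choice. -/
def getsItem (p : Prices n) (i : Fin n) : Set (Fin n → ℝ) :=
  {x | ∃ I, i ∈ I ∧ x ∈ optSet p Finset.univ I}

lemma measurableSet_getsItem (p : Prices n) (i : Fin n) : MeasurableSet (getsItem p i) := by
  have : getsItem p i = ⋃ I ∈ {I : Finset (Fin n) | i ∈ I}, optSet p Finset.univ I := by
    ext x; simp [getsItem]
  rw [this]
  exact MeasurableSet.biUnion (Set.to_countable _)
    fun I _ => (isClosed_optSet p _ I).measurableSet

lemma integrable_indicator_getsItem (p : Prices n) (i : Fin n) :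
    Integrable ((getsItem p i).indicator fun x => x i) (unif n) :=
  (integrable_unif_of_continuous (continuous_apply i)).indicator (measurableSet_getsItem p i)

/-- Integration by parts in the coordinate `x_i`, for the utility, whose partial derivative is the
indicator of `getsItem p i`. -/
lemma integral_indicator_getsItem (p : Prices n) (i : Fin n) :
    ∫ x, (getsItem p i).indicator (fun x => x i) x ∂unif n
      = ∫ x, util p (Function.update x i 1) ∂unif n - ∫ x, util p x ∂unif n := by
  have hint := integrable_indicator_getsItem p i
  rw [eq_sub_iff_add_eq, ← integral_add hint (integrable_util p)]
  set f : (Fin n → ℝ) → ℝ := fun x => (getsItem p i).indicator (fun x => x i) x + util p x with hf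
  have hint2 : Integrable f (unif n) := hint.add (integrable_util p)
  have hmp := measurePreserving_update i
  have h1 : Integrable (fun q : (Fin n → ℝ) × ℝ => f (Function.update q.1 i q.2))
      ((unif n).prod (volume.restrict (Set.Icc 0 1))) := hmp.integrable_comp_of_integrable hint2
  have h2 : ∫ x, f x ∂unif n = ∫ q : (Fin n → ℝ) × ℝ, f (Function.update q.1 i q.2)
      ∂((unif n).prod (volume.restrict (Set.Icc 0 1))) := by
    rw [← integral_map hmp.measurable.aemeasurable
      (by rw [hmp.map_eq]; exact hint2.aestronglyMeasurable), hmp.map_eq]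
  rw [h2, integral_prod _ h1]
  refine integral_congr_ae (Filter.Eventually.of_forall fun x => ?_)
  obtain ⟨a, b, hab⟩ := exists_util_update_eq_max p i x
  simp only
  rw [(hab 1).1, ← integral_max_add_indicator a b]
  refine integral_congr_ae (Filter.Eventually.of_forall fun t => ?_)
  simp only [hf, (hab t).1]
  congr 1
  have hmem : Function.update x i t ∈ getsItem p i ↔ a ≤ b + t := (hab t).2
  by_cases h : a ≤ b + t
  · rw [if_pos h, Set.indicator_of_mem (hmem.2 h), Function.update_self]
  · rw [if_neg h, Set.indicator_of_notMem (fun h' => h (hmem.1 h'))]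

/-- The revenue in terms of the utility alone. It is the divergence theorem for the vector field
`x ↦ u(x) x` on the cube, where `u` is the utility: its divergence is `n u + x · ∇u`, and the
payment is `x · ∇u - u`. -/
lemma revenue_eq_integral_util (p : Prices n) :
    revenue p = ∑ i, ∫ x, util p (Function.update x i 1) ∂unif n
      - ((n : ℝ) + 1) * ∫ x, util p x ∂unif n := by
  have hmeas : ∀ I, MeasurableSet (optSet p Finset.univ I) := fun I =>
    (isClosed_optSet p _ I).measurableSet
  have hrev : revenue p
      = ∫ x, ∑ I, (optSet p Finset.univ I).indicator (fun _ => p I) x ∂unif n := by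
    rw [integral_finsetSum _ fun I _ => (integrable_const _).indicator (hmeas I)]
    refine Finset.sum_congr rfl fun I _ => ?_
    rw [integral_indicator_const _ (hmeas I), volume_real_region, smul_eq_mul, mul_comm]
  have hae : ∀ᵐ x ∂unif n, ∀ I J, I ≠ J → ∑ i ∈ I, x i - ∑ i ∈ J, x i ≠ p I - p J := by
    rw [ae_all_iff]; intro I
    rw [ae_all_iff]; intro J
    by_cases hIJ : I = J
    · simp [hIJ]
    · refine (measure_eq_zero_iff_ae_notMem.1 (unif_tie hIJ (p I - p J))).mono fun x hx _ => hx
  -- almost surely the best choice `I` is unique, and then `p I = ∑ i ∈ I, x i - util p x`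
  have hpt : (fun x => ∑ I, (optSet p Finset.univ I).indicator (fun _ => p I) x) =ᵐ[unif n]
      fun x => ∑ i, (getsItem p i).indicator (fun x => x i) x - util p x := by
    filter_upwards [hae] with x hx
    obtain ⟨I, hI⟩ := exists_eq_util p x
    have huniq : ∀ J, x ∈ optSet p Finset.univ J ↔ J = I := by
      intro J
      rw [mem_optSet_univ_iff]
      refine ⟨fun h => ?_, fun h => h ▸ hI⟩
      by_contra hne
      exact hx J I hne (by linarith)
    rw [hI, Finset.sum_eq_single I (fun J _ hJ => ?_) (by simp),
      Set.indicator_of_mem ((huniq I).2 rfl)]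
    · have hg : ∀ i, (getsItem p i).indicator (fun x => x i) x = if i ∈ I then x i else 0 := by
        intro i
        have hmem : x ∈ getsItem p i ↔ i ∈ I := by simp [getsItem, huniq]
        by_cases h : i ∈ I
        · rw [if_pos h, Set.indicator_of_mem (hmem.2 h)]
        · rw [if_neg h, Set.indicator_of_notMem (fun h' => h (hmem.1 h'))]
      simp only [hg, Finset.sum_ite_mem, Finset.univ_inter]
      ring
    · exact Set.indicator_of_notMem (fun h => hJ ((huniq J).1 h)) _
  rw [hrev, integral_congr_ae hpt,
    integral_sub (integrable_finsetSum _ fun i _ => integrable_indicator_getsItem p i)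
      (integrable_util p),
    integral_finsetSum _ fun i _ => integrable_indicator_getsItem p i]
  simp only [integral_indicator_getsItem, Finset.sum_sub_distrib, Finset.sum_const,
    Finset.card_univ, Fintype.card_fin, nsmul_eq_mul]
  ring

lemma revenue_congr {p q : Prices n} (h : ∀ x ∈ cube n, util p x = util q x) :
    revenue p = revenue q := by
  rw [revenue_eq_integral_util, revenue_eq_integral_util]
  congr 1
  · refine Finset.sum_congr rfl fun i _ => integral_congr_ae ?_
    filter_upwards [ae_mem_cube] with x hx
    refine h _ (mem_cube.2 fun j => ?_)
    by_cases hj : j = i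
    · subst hj; simp
    · simpa [hj] using mem_cube.1 hx j
  · congr 1
    refine integral_congr_ae ?_
    filter_upwards [ae_mem_cube] with x hx using h x hx

lemma continuous_revenue : Continuous (revenue : Prices n → ℝ) := by
  have key : ∀ f : Prices n × (Fin n → ℝ) → ℝ, Continuous f →
      Continuous fun p => ∫ x, f (p, x) ∂unif n := by
    intro f hf
    rw [unif_eq_restrict]
    exact continuous_parametric_integral_of_continuous (μ := volume)
      (f := fun (p : Prices n) (x : Fin n → ℝ) => f (p, x)) hf isCompact_cube
  have h : (revenue : Prices n → ℝ) = fun p => ∑ i, ∫ x, util p (Function.update x i 1) ∂unif n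
      - ((n : ℝ) + 1) * ∫ x, util p x ∂unif n := funext revenue_eq_integral_util
  have h1 : ∀ i : Fin n, Continuous fun p : Prices n =>
      ∫ x, util p (Function.update x i 1) ∂unif n := by
    intro i
    have hc : Continuous fun q : Prices n × (Fin n → ℝ) => (q.1, Function.update q.2 i 1) := by
      fun_prop
    have hu : Continuous fun q : Prices n × (Fin n → ℝ) => util q.1 (Function.update q.2 i 1) := by
      have := continuous_util.comp hc
      exact this
    exact key (fun q => util q.1 (Function.update q.2 i 1)) hu
  have h2 : Continuous fun p : Prices n => ∫ x, util p x ∂unif n := key _ continuous_util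
  rw [h]
  exact (continuous_finsetSum _ fun i _ => h1 i).sub (continuous_const.mul h2)

/-! ### Change of the revenue when prices are lowered -/

/-- The schedule `p` with the prices of all bundles with `k` items lowered by `s`. -/
def lowerPrice (p : Prices n) (k : ℕ) (s : ℝ) : Prices n :=
  fun I => if I.card = k then p I - s else p I

/-- The valuations for which some bundle with `k` items is a best choice. -/
def sizeSet (p : Prices n) (k : ℕ) : Set (Fin n → ℝ) :=
  ⋃ I ∈ Finset.univ.filter (fun I : Finset (Fin n) => I.card = k), optSet p Finset.univ I

/-- The rate at which the revenue changes when the prices of the bundles with `k` items are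
lowered. -/
noncomputable def lowerRate (p : Prices n) (k : ℕ) : ℝ :=
  ∑ i, (unif n).real {x | Function.update x i 1 ∈ sizeSet p k}
    - ((n : ℝ) + 1) * (unif n).real (sizeSet p k)

lemma mem_sizeSet {p : Prices n} {k : ℕ} {x : Fin n → ℝ} :
    x ∈ sizeSet p k ↔ ∃ I : Finset (Fin n), I.card = k ∧ x ∈ optSet p Finset.univ I := by
  simp [sizeSet]

/-- The utility gains at least `τ` from lowering a price by `s` if and only if the buyer already
chooses that size when the price is lowered by `s - τ` only. -/
lemma le_util_lowerPrice_sub_iff (p : Prices n) (k : ℕ) {s τ : ℝ} (hτ : 0 < τ) (hs : τ ≤ s)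
    (x : Fin n → ℝ) : τ ≤ util (lowerPrice p k s) x - util p x ↔
      x ∈ sizeSet (lowerPrice p k (s - τ)) k := by
  rw [mem_sizeSet]
  constructor
  · intro h
    obtain ⟨I, hI⟩ := exists_eq_util (lowerPrice p k s) x
    have h1 := le_util p x I
    have hk : I.card = k := by
      by_contra hk
      simp only [lowerPrice, hk, if_false] at hI
      linarith
    refine ⟨I, hk, fun J _ => ?_⟩
    have h2 := le_util (lowerPrice p k s) x J
    have h3 := le_util p x J
    rw [hI] at h h2
    simp only [lowerPrice, hk, if_true] at h h2 ⊢
    by_cases hJ : J.card = k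
    · simp only [hJ, if_true] at h2 ⊢
      linarith
    · simp only [hJ, if_false] at h2 ⊢
      linarith
  · rintro ⟨I, hk, hI⟩
    have h1 := le_util (lowerPrice p k s) x I
    have h2 : util p x ≤ ∑ i ∈ I, x i - p I + s - τ := by
      refine util_le fun J => ?_
      have := hI J (Finset.subset_univ J)
      simp only [lowerPrice, hk, if_true] at this
      by_cases hJ : J.card = k
      · simp only [hJ, if_true] at this
        linarith
      · simp only [hJ, if_false] at this
        linarith
    simp only [lowerPrice, hk, if_true] at h1
    linarith

lemma util_le_util_lowerPrice (p : Prices n) (k : ℕ) {s : ℝ} (hs : 0 ≤ s) (x : Fin n → ℝ) :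
    util p x ≤ util (lowerPrice p k s) x := by
  refine util_le fun J => le_trans ?_ (le_util (lowerPrice p k s) x J)
  by_cases hJ : J.card = k
  · simp only [lowerPrice, hJ, if_true]; linarith
  · simp only [lowerPrice, hJ, if_false]; linarith

lemma util_lowerPrice_le (p : Prices n) (k : ℕ) {s : ℝ} (hs : 0 ≤ s) (x : Fin n → ℝ) :
    util (lowerPrice p k s) x ≤ util p x + s := by
  refine util_le fun J => ?_
  have := le_util p x J
  by_cases hJ : J.card = k
  · simp only [lowerPrice, hJ, if_true]; linarith
  · simp only [lowerPrice, hJ, if_false]; linarith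

lemma integrableOn_unif_real_le (f : (Fin n → ℝ) → ℝ) (s : ℝ) :
    IntegrableOn (fun τ => (unif n).real {x | τ ≤ f x}) (Set.Ioc 0 s) := by
  have : Antitone fun τ => (unif n).real {x | τ ≤ f x} := fun a b hab =>
    unif_real_mono fun x hx => hab.trans hx
  exact (this.antitoneOn _).integrableOn_isCompact isCompact_Icc |>.mono_set Set.Ioc_subset_Icc_self

/-- The change of the revenue when prices of bundles of one size are lowered is the integral of
its rate; this is the layer cake formula for the change of the utility. -/
lemma revenue_lowerPrice_sub (p : Prices n) (k : ℕ) {s : ℝ} (hs : 0 ≤ s) :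
    IntegrableOn (fun τ => lowerRate (lowerPrice p k (s - τ)) k) (Set.Ioc 0 s) ∧
    revenue (lowerPrice p k s) - revenue p
      = ∫ τ in Set.Ioc 0 s, lowerRate (lowerPrice p k (s - τ)) k := by
  set D : (Fin n → ℝ) → ℝ := fun x => util (lowerPrice p k s) x - util p x with hD
  have hDc : Continuous D := (continuous_util_right _).sub (continuous_util_right _)
  have hcake : ∀ f : (Fin n → ℝ) → (Fin n → ℝ), Continuous f →
      ∫ x, D (f x) ∂unif n = ∫ τ in Set.Ioc 0 s, (unif n).real {x | τ ≤ D (f x)} := by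
    intro f hf
    refine Integrable.integral_eq_integral_Ioc_meas_le
      (integrable_unif_of_continuous (hDc.comp hf))
      (Filter.Eventually.of_forall fun x => ?_) (Filter.Eventually.of_forall fun x => ?_)
    · exact sub_nonneg.2 (util_le_util_lowerPrice p k hs _)
    · have := util_lowerPrice_le p k hs (f x)
      simp only [hD]; linarith
  have hrate : Set.EqOn (fun τ => lowerRate (lowerPrice p k (s - τ)) k)
      (fun τ => ∑ i, (unif n).real {x | τ ≤ D (Function.update x i 1)}
        - ((n : ℝ) + 1) * (unif n).real {x | τ ≤ D x}) (Set.Ioc 0 s) := by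
    intro τ hτ
    simp only [lowerRate, hD, le_util_lowerPrice_sub_iff p k hτ.1 hτ.2]
    rfl
  have hi1 : ∀ i ∈ Finset.univ, IntegrableOn
      (fun τ => (unif n).real {x | τ ≤ D (Function.update x i 1)}) (Set.Ioc 0 s) :=
    fun i _ => integrableOn_unif_real_le _ s
  have hi2 := (integrableOn_unif_real_le D s).const_mul ((n : ℝ) + 1)
  refine ⟨(integrableOn_congr_fun hrate measurableSet_Ioc).2
    ((integrable_finsetSum _ hi1).sub hi2), ?_⟩
  rw [setIntegral_congr_fun measurableSet_Ioc hrate, integral_sub (integrable_finsetSum _ hi1) hi2,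
    integral_finsetSum _ hi1, integral_const_mul, ← hcake (fun x => x) continuous_id,
    Finset.sum_congr rfl fun i _ => (hcake (fun x => Function.update x i 1) (by fun_prop)).symm,
    revenue_eq_integral_util, revenue_eq_integral_util, integral_sub (integrable_util _)
      (integrable_util _)]
  simp only [hD]
  rw [Finset.sum_congr rfl fun i _ => integral_sub (integrable_util_update _ i)
    (integrable_util_update _ i), Finset.sum_sub_distrib]
  ring

lemma revenue_lt_revenue_lowerPrice (p : Prices n) (k : ℕ) {s : ℝ} (hs : 0 < s)
    (h : ∀ σ, 0 < σ → σ < s → 0 < lowerRate (lowerPrice p k σ) k) :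
    revenue p < revenue (lowerPrice p k s) := by
  obtain ⟨hi, he⟩ := revenue_lowerPrice_sub p k hs.le
  rw [← sub_pos, he, ← intervalIntegral.integral_of_le hs.le]
  refine intervalIntegral.intervalIntegral_pos_of_pos_on
    ((intervalIntegrable_iff_integrableOn_Ioc_of_le hs.le).2 hi) (fun τ hτ => ?_) hs
  exact h _ (by linarith [hτ.2]) (by linarith [hτ.1])

lemma revenue_lowerPrice_lt_revenue (p : Prices n) (k : ℕ) {s : ℝ} (hs : 0 < s)
    (h : ∀ σ, 0 < σ → σ < s → lowerRate (lowerPrice p k σ) k < 0) :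
    revenue (lowerPrice p k s) < revenue p := by
  obtain ⟨hi, he⟩ := revenue_lowerPrice_sub p k hs.le
  rw [← sub_neg, he, ← intervalIntegral.integral_of_le hs.le, ← neg_pos,
    ← intervalIntegral.integral_neg]
  refine intervalIntegral.intervalIntegral_pos_of_pos_on
    ((intervalIntegrable_iff_integrableOn_Ioc_of_le hs.le).2 hi).neg (fun τ hτ => ?_) hs
  exact neg_pos.2 (h _ (by linarith [hτ.2]) (by linarith [hτ.1]))

/-- A bundle without item `i` is never a best choice for `x_i = 1` if the marginal price of `i` is
less than one. -/
lemma update_notMem_optSet {p : Prices n} {S I : Finset (Fin n)} {i : Fin n} (hiS : i ∈ S)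
    (hIS : I ⊆ S) (hi : i ∉ I) (h : p (insert i I) - p I < 1) (x : Fin n → ℝ) :
    Function.update x i 1 ∉ optSet p S I := by
  intro hx
  have h1 := hx (insert i I) (Finset.insert_subset hiS hIS)
  rw [Finset.sum_insert hi, Function.update_self] at h1
  linarith

/-- For each bundle `I`, its share in the revenue's rate of change is a multiple of its
deficiency. -/
lemma optSet_balance {p : Prices n} (hp : IsSubmodular p) {S I : Finset (Fin n)} (hI : I ⊆ S) :
    ((n : ℝ) + 1) * (unif n).real (optSet p S I)
      - ∑ i ∈ I, (unif n).real {x | Function.update x i 1 ∈ optSet p S I}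
      = ((n : ℝ) + 1) * ((unif n).real (lowerPart p S I) * cubeDeficiency p I) := by
  rw [unif_real_optSet hp hI, Finset.sum_congr rfl fun i hi => unif_real_update_optSet hp hI hi,
    ← Finset.sum_mul, cubeDeficiency]
  have : (n : ℝ) + 1 ≠ 0 := by positivity
  field_simp

/-- The faces `x_i = 1` with `i ∉ I` do not meet the region of `I`, by the assumption on the
marginal prices. -/
lemma lowerRate_eq {p : Prices n} (hp : IsSubmodular p) {k : ℕ}
    (h1 : ∀ I : Finset (Fin n), I.card = k → ∀ i ∉ I, p (insert i I) - p I < 1) :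
    lowerRate p k = -(((n : ℝ) + 1) * ∑ I with I.card = k,
      (unif n).real (lowerPart p Finset.univ I) * cubeDeficiency p I) := by
  have hface : ∀ i : Fin n, (unif n).real {x | Function.update x i 1 ∈ sizeSet p k}
      = ∑ I with I.card = k ∧ i ∈ I,
        (unif n).real {x | Function.update x i 1 ∈ optSet p Finset.univ I} := by
    intro i
    rw [← unif_real_biUnion_update_optSet p _ (fun I _ => Finset.subset_univ I)
      fun I hI => (Finset.mem_filter.1 hI).2.2]
    congr 1
    ext x
    simp only [Set.mem_ofPred_eq, mem_sizeSet, Set.mem_iUnion, Finset.mem_filter, Finset.mem_univ,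
      true_and, exists_prop]
    refine exists_congr fun I => ⟨fun ⟨hk, hx⟩ => ⟨⟨hk, ?_⟩, hx⟩, fun ⟨hk, hx⟩ => ⟨hk.1, hx⟩⟩
    by_contra hi
    exact update_notMem_optSet (Finset.mem_univ i) (Finset.subset_univ I) hi (h1 I hk i hi) x hx
  have hvol : (unif n).real (sizeSet p k)
      = ∑ I with I.card = k, (unif n).real (optSet p Finset.univ I) :=
    unif_real_biUnion_optSet p _ fun I _ => Finset.subset_univ I
  have hswap : ∑ i, ∑ I with I.card = k ∧ i ∈ I,
        (unif n).real {x | Function.update x i 1 ∈ optSet p Finset.univ I}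
      = ∑ I with I.card = k, ∑ i ∈ I,
        (unif n).real {x | Function.update x i 1 ∈ optSet p Finset.univ I} :=
    Finset.sum_comm' (by simp [and_comm])
  rw [lowerRate, hvol, Finset.sum_congr rfl fun i _ => hface i, hswap, Finset.mul_sum,
    Finset.mul_sum, ← Finset.sum_sub_distrib, ← Finset.sum_neg_distrib]
  refine Finset.sum_congr rfl fun I _ => ?_
  rw [← optSet_balance hp (Finset.subset_univ I)]
  ring

/-! ### Symmetric schedules as concave sequences -/

/-- The symmetric price schedule with price `P k` for the bundles with `k` items. -/
def sizePrices (P : ℕ → ℝ) : Prices n := fun I => P I.card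

/-- Concavity of `P 0 = 0, P 1, …, P n`: this is submodularity of the symmetric schedule. -/
structure IsConcaveSeq (n : ℕ) (P : ℕ → ℝ) : Prop where
  zero : P 0 = 0
  concave : ∀ k, k + 2 ≤ n → P (k + 2) + P k ≤ 2 * P (k + 1)

/-- `P 0 ≤ P 1 ≤ … ≤ P n`. -/
def IsMonoSeq (n : ℕ) (P : ℕ → ℝ) : Prop := ∀ k < n, P k ≤ P (k + 1)

namespace IsConcaveSeq
variable {P : ℕ → ℝ} (hP : IsConcaveSeq n P)
include hP

lemma increment_anti {a b : ℕ} (hab : a ≤ b) (hb : b < n) :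
    P (b + 1) - P b ≤ P (a + 1) - P a := by
  induction b, hab using Nat.le_induction with
  | base => exact le_rfl
  | succ b _ ih =>
    have h1 := ih (by omega)
    have h2 := hP.concave b (by omega)
    linarith

lemma shift_anti {a b : ℕ} (hab : a ≤ b) (m : ℕ) (hb : b + m ≤ n) :
    P (b + m) - P b ≤ P (a + m) - P a := by
  induction m with
  | zero => simp
  | succ m ih =>
    have h1 := ih (by omega)
    have h2 := hP.increment_anti (Nat.add_le_add_right hab m) (by omega)
    rw [← add_assoc, ← add_assoc]
    linarith

lemma increment_le {k : ℕ} (hk : k < n) : P (k + 1) - P k ≤ P 1 := by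
  have := hP.increment_anti (Nat.zero_le k) hk
  rw [hP.zero] at this
  simpa using this

lemma mul_increment_le {s j : ℕ} (hsj : s ≤ j) (hj : j < n) :
    (s : ℝ) * (P (j + 1) - P j) ≤ P s := by
  induction s with
  | zero => simp [hP.zero]
  | succ s ih =>
    have h1 := ih (by omega)
    have h2 := hP.increment_anti (show s ≤ j by omega) hj
    push_cast
    linarith

/-- Concave sequences from `0` lie above their chords from `0`. -/
lemma chord_le {s j : ℕ} (hsj : s ≤ j) (hj : j ≤ n) : (s : ℝ) * P j ≤ j * P s := by
  induction j, hsj using Nat.le_induction with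
  | base => exact le_rfl
  | succ j hsj ih =>
    have h1 := ih (by omega)
    have h2 := hP.mul_increment_le hsj (by omega)
    push_cast
    linarith

lemma le_mul {k : ℕ} (hk : k ≤ n) : P k ≤ k * P 1 := by
  rcases Nat.eq_zero_or_pos k with rfl | h
  · simp [hP.zero]
  · simpa using hP.chord_le (s := 1) h hk

lemma isMonoSeq (h : ∀ m, m + 1 = n → P m ≤ P n) : IsMonoSeq n P := by
  intro k hk
  have h1 := hP.increment_anti (show k ≤ n - 1 by omega) (by omega)
  have h2 := h (n - 1) (by omega)
  rw [Nat.sub_add_cancel (by omega)] at h1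
  linarith

lemma eq_of_increment_eq_zero (hm : IsMonoSeq n P) {k : ℕ} (hk : P k = P (k + 1)) {l : ℕ}
    (hkl : k ≤ l) (hl : l ≤ n) : P l = P k := by
  induction l, hkl using Nat.le_induction with
  | base => rfl
  | succ l hkl ih =>
    have h1 := hP.increment_anti hkl (by omega)
    have h2 := hm l (by omega)
    have h3 := ih (by omega)
    linarith

lemma isSubmodular : IsSubmodular (sizePrices P : Prices n) := by
  intro I J
  have h1 := Finset.card_union_add_card_inter I J
  have h2 := Finset.card_le_card (Finset.inter_subset_left : I ∩ J ⊆ I)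
  have h3 := Finset.card_le_card (Finset.inter_subset_right : I ∩ J ⊆ J)
  have h4 := Finset.card_le_univ (I ∪ J)
  rw [Fintype.card_fin] at h4
  have h5 := hP.shift_anti h3 (I.card - (I ∩ J).card) (by omega)
  simp only [sizePrices]
  rw [show J.card + (I.card - (I ∩ J).card) = (I ∪ J).card by omega,
    show (I ∩ J).card + (I.card - (I ∩ J).card) = I.card by omega] at h5
  linarith

lemma isSymmSubmodular : IsSymmSubmodular (sizePrices P : Prices n) :=
  ⟨by simp [sizePrices, hP.zero], hP.isSubmodular, fun I J h => by simp [sizePrices, h]⟩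

end IsConcaveSeq

namespace IsMonoSeq
variable {P : ℕ → ℝ} (hP : IsMonoSeq n P)
include hP

lemma le {a b : ℕ} (hab : a ≤ b) (hb : b ≤ n) : P a ≤ P b := by
  induction b, hab using Nat.le_induction with
  | base => exact le_rfl
  | succ b _ ih => exact (ih (by omega)).trans (hP b (by omega))

lemma le_of_subset {I J : Finset (Fin n)} (h : I ⊆ J) :
    (sizePrices P : Prices n) I ≤ sizePrices P J :=
  hP.le (Finset.card_le_card h) (by simpa using Finset.card_le_univ J)

end IsMonoSeq

lemma card_le (I : Finset (Fin n)) : I.card ≤ n := by simpa using Finset.card_le_univ I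

lemma card_lt_of_notMem {I : Finset (Fin n)} {i : Fin n} (hi : i ∉ I) : I.card < n := by
  have := card_le (insert i I)
  rw [Finset.card_insert_of_notMem hi] at this
  exact this

lemma exists_notMem {I : Finset (Fin n)} (h : I.card < n) : ∃ i, i ∉ I := by
  by_contra! hI
  rw [(Finset.eq_univ_iff_forall.2 hI), Finset.card_univ, Fintype.card_fin] at h
  exact lt_irrefl _ h

lemma ne_univ_iff_card_lt {I : Finset (Fin n)} : I ≠ Finset.univ ↔ I.card < n := by
  constructor
  · intro h
    refine lt_of_le_of_ne (card_le I) fun hc => h ?_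
    exact Finset.eq_univ_of_card I (by simpa using hc)
  · rintro h rfl
    simp at h

lemma exists_card_eq {k : ℕ} (hk : k ≤ n) : ∃ I : Finset (Fin n), I.card = k := by
  obtain ⟨I, -, hI⟩ := Finset.exists_subset_card_eq
    (s := (Finset.univ : Finset (Fin n))) (n := k) (by simpa using hk)
  exact ⟨I, hI⟩

lemma insert_union_insert (T : Finset (Fin n)) (a b : Fin n) :
    insert a T ∪ insert b T = insert a (insert b T) := by
  rw [Finset.insert_union, Finset.union_insert, Finset.union_self]

lemma insert_inter_insert {T : Finset (Fin n)} {a b : Fin n} (ha : a ∉ T) (hb : b ∉ T)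
    (hab : a ≠ b) : insert a T ∩ insert b T = T := by
  ext i
  simp only [Finset.mem_inter, Finset.mem_insert]
  constructor
  · rintro ⟨rfl | h, rfl | h'⟩ <;> first | assumption | exact absurd rfl hab
  · exact fun h => ⟨Or.inr h, Or.inr h⟩

/-- Submodularity for the pair `T ∪ {a}`, `T ∪ {b}` is concavity at `|T| + 1`. -/
lemma isTightPair_insert {P : ℕ → ℝ} {T : Finset (Fin n)} {a b : Fin n} (ha : a ∉ T) (hb : b ∉ T)
    (hab : a ≠ b) (h : P (T.card + 2) + P T.card = 2 * P (T.card + 1)) :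
    IsTightPair (sizePrices P) (insert a T) (insert b T) := by
  refine ⟨fun hs => ?_, fun hs => ?_, ?_⟩
  · have := hs (Finset.mem_insert_self a T)
    simp [ha, hab] at this
  · have := hs (Finset.mem_insert_self b T)
    simp [hb, hab.symm] at this
  · have h1 : (insert a T ∪ insert b T).card = T.card + 2 := by
      rw [insert_union_insert, Finset.card_insert_of_notMem (by simp [ha, hab]),
        Finset.card_insert_of_notMem hb]
    simp only [sizePrices, h1, insert_inter_insert ha hb hab, Finset.card_insert_of_notMem ha,
      Finset.card_insert_of_notMem hb]
    linarith

lemma exists_two_notMem {T : Finset (Fin n)} (h : T.card + 2 ≤ n) :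
    ∃ a b, a ∉ T ∧ b ∉ T ∧ a ≠ b := by
  obtain ⟨a, ha⟩ := exists_notMem (I := T) (by omega)
  obtain ⟨b, hb⟩ := exists_notMem (I := insert a T) (by
    rw [Finset.card_insert_of_notMem ha]; omega)
  rw [Finset.mem_insert, not_or] at hb
  exact ⟨a, b, ha, hb.2, fun h => hb.1 h.symm⟩

lemma isConcaveSeq_of_isSymmSubmodular {P : ℕ → ℝ}
    (h : IsSymmSubmodular (sizePrices P : Prices n)) : IsConcaveSeq n P := by
  refine ⟨by simpa [sizePrices] using h.1, fun k hk => ?_⟩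
  obtain ⟨T, rfl⟩ := exists_card_eq (n := n) (k := k) (by omega)
  obtain ⟨a, b, ha, hb, hab⟩ := exists_two_notMem hk
  have := h.2.1 (insert a T) (insert b T)
  rw [insert_union_insert, insert_inter_insert ha hb hab] at this
  simp only [sizePrices, Finset.card_insert_of_notMem hb, Finset.card_insert_of_notMem ha,
    Finset.card_insert_of_notMem (show a ∉ insert b T by simp [ha, hab])] at this
  linarith

lemma exists_eq_sizePrices {p : Prices n} (hp : IsSymmetric p) : ∃ P, p = sizePrices P := by
  classical
  refine ⟨fun k => if h : ∃ I : Finset (Fin n), I.card = k then p h.choose else 0,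
    funext fun I => ?_⟩
  have h : ∃ J : Finset (Fin n), J.card = I.card := ⟨I, rfl⟩
  simp only [sizePrices, dif_pos h]
  exact hp _ _ h.choose_spec.symm

lemma exists_concaveSeq {p : Prices n} (hp : IsSymmSubmodular p) :
    ∃ P, p = sizePrices P ∧ IsConcaveSeq n P := by
  obtain ⟨P, rfl⟩ := exists_eq_sizePrices hp.2.2
  exact ⟨P, rfl, isConcaveSeq_of_isSymmSubmodular hp⟩

lemma isRightTight_of_eq {P : ℕ → ℝ} {I : Finset (Fin n)} {k : ℕ} (hI : I.card = k + 1)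
    (hk : k + 2 ≤ n) (h : P (k + 2) + P k = 2 * P (k + 1)) : IsRightTight (sizePrices P) I := by
  obtain ⟨a, ha⟩ : I.Nonempty := Finset.card_pos.1 (by omega)
  obtain ⟨b, hb⟩ := exists_notMem (I := I) (by omega)
  have hT : (I.erase a).card = k := by rw [Finset.card_erase_of_mem ha, hI]; rfl
  refine ⟨insert b (I.erase a), ?_⟩
  have := isTightPair_insert (P := P) (T := I.erase a) (a := a) (b := b) (by simp)
    (fun h => hb (Finset.mem_of_mem_erase h)) (fun h => hb (h ▸ ha)) (by rw [hT]; exact h)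
  rwa [Finset.insert_erase ha] at this

lemma isLeftTight_of_eq_below {P : ℕ → ℝ} {I : Finset (Fin n)} {k : ℕ} (hI : I.card = k + 2)
    (h : P (k + 2) + P k = 2 * P (k + 1)) : IsLeftTight (sizePrices P) I := by
  obtain ⟨a, ha, b, hb, hab⟩ := Finset.one_lt_card.1 (show 1 < I.card by omega)
  set T := (I.erase a).erase b with hT
  have hb' : b ∈ I.erase a := Finset.mem_erase.2 ⟨hab.symm, hb⟩
  have hTc : T.card = k := by
    rw [hT, Finset.card_erase_of_mem hb', Finset.card_erase_of_mem ha, hI]; rfl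
  refine ⟨insert a T, insert b T, isTightPair_insert (by simp [hT]) (by simp [hT]) hab
    (by rw [hTc]; exact h), Or.inl ?_⟩
  rw [insert_union_insert, hT, Finset.insert_erase hb', Finset.insert_erase ha]

lemma isLeftTight_of_eq_above {P : ℕ → ℝ} {I : Finset (Fin n)} (hk : I.card + 2 ≤ n)
    (h : P (I.card + 2) + P I.card = 2 * P (I.card + 1)) : IsLeftTight (sizePrices P) I := by
  obtain ⟨a, b, ha, hb, hab⟩ := exists_two_notMem hk
  exact ⟨insert a I, insert b I, isTightPair_insert ha hb hab h,
    Or.inr (insert_inter_insert ha hb hab).symm⟩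

lemma isDegenerate_of_eq {P : ℕ → ℝ} {k : ℕ} (hk : k + 2 ≤ n)
    (h : P (k + 2) + P k = 2 * P (k + 1)) : IsDegenerate (sizePrices P : Prices n) := by
  obtain ⟨I, hI⟩ := exists_card_eq (n := n) (k := k + 1) (by omega)
  obtain ⟨J, hJ⟩ := isRightTight_of_eq hI hk h
  exact ⟨I, J, hJ⟩

lemma unif_real_tie {I J : Finset (Fin n)} (h : I ≠ J) (c : ℝ) {A : Set (Fin n → ℝ)}
    (hA : ∀ x ∈ cube n, x ∈ A → ∑ i ∈ I, x i - ∑ i ∈ J, x i = c) : (unif n).real A = 0 := by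
  rw [measureReal_eq_zero_iff]
  refine measure_mono_null_ae ?_ (unif_tie h c)
  filter_upwards [ae_mem_cube] with x hx hxA using hA x hx hxA

lemma unif_real_le_zero (i : Fin n) {A : Set (Fin n → ℝ)} (hA : ∀ x ∈ A, x i ≤ 0) :
    (unif n).real A = 0 := by
  refine unif_real_tie (Finset.singleton_ne_empty i) 0 fun x hx hxA => ?_
  simpa using le_antisymm (hA x hxA) (mem_cube.1 hx i).1

lemma unif_real_one_le (i : Fin n) {A : Set (Fin n → ℝ)} (hA : ∀ x ∈ A, 1 ≤ x i) :
    (unif n).real A = 0 := by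
  refine unif_real_tie (Finset.singleton_ne_empty i) 1 fun x hx hxA => ?_
  simpa using le_antisymm (mem_cube.1 hx i).2 (hA x hxA)

lemma apply_le_of_mem_lowerPart {P : ℕ → ℝ} {S I : Finset (Fin n)} {i : Fin n} (hi : i ∈ S \ I)
    {x : Fin n → ℝ} (hx : x ∈ lowerPart (sizePrices P) S I) :
    x i ≤ P (I.card + 1) - P I.card := by
  have := hx {i} (by simpa using hi)
  rw [Finset.sum_singleton, sizePrices, sizePrices, Finset.card_union_of_disjoint
    (by simpa using (Finset.mem_sdiff.1 hi).2), Finset.card_singleton] at this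
  exact this

lemma unif_real_lowerPart_eq_zero {P : ℕ → ℝ} {I : Finset (Fin n)} (hI : I.card < n)
    (h : P (I.card + 1) ≤ P I.card) :
    (unif n).real (lowerPart (sizePrices P) Finset.univ I) = 0 := by
  obtain ⟨i, hi⟩ := exists_notMem hI
  refine unif_real_le_zero i fun x hx => ?_
  have := apply_le_of_mem_lowerPart (by simpa using hi) hx
  linarith

/-- There is `v ∈ (0, 1)` below finitely many positive bounds. -/
lemma exists_mul_lt {c : ℕ → ℝ} (m : ℕ) (hc : ∀ l, 0 < c l) :
    ∃ v : ℝ, 0 < v ∧ v < 1 ∧ ∀ l ≤ m, (l : ℝ) * v < c l := by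
  have h : ∀ᶠ v in nhdsWithin (0 : ℝ) (Set.Ioi 0), ∀ l ∈ Finset.range (m + 1),
      (l : ℝ) * v < c l := by
    rw [Filter.eventually_all_finset]
    intro l _
    have : Filter.Tendsto (fun v : ℝ => (l : ℝ) * v) (nhdsWithin 0 (Set.Ioi 0)) (nhds 0) :=
      ((by fun_prop : Continuous fun v : ℝ => (l : ℝ) * v).tendsto' 0 0 (by simp)).mono_left
        nhdsWithin_le_nhds
    exact this.eventually_lt_const (hc l)
  obtain ⟨v, hv, h0, h1⟩ := (h.and (Ioo_mem_nhdsGT (zero_lt_one' ℝ))).exists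
  exact ⟨v, h0, h1, fun l hl => hv l (Finset.mem_range.2 (by omega))⟩

/-- The lower part contains valuations with small equal entries in its interior. -/
lemma unif_real_lowerPart_pos {P : ℕ → ℝ} {I : Finset (Fin n)}
    (h : ∀ l, I.card < l → l ≤ n → P I.card < P l) :
    0 < (unif n).real (lowerPart (sizePrices P) Finset.univ I) := by
  obtain ⟨v, hv0, hv1, hv⟩ := exists_mul_lt (c := fun m => if 0 < m ∧ I.card + m ≤ n then
    P (I.card + m) - P I.card else 1) n (fun l => by
      split_ifs with hl
      · exact sub_pos.2 (h _ (by omega) hl.2)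
      · exact one_pos)
  let U : Set (Fin n → ℝ) := {x | ∀ K : Finset (Fin n), K ⊆ Finset.univ \ I → K.Nonempty →
    ∑ i ∈ K, x i < P (I.card + K.card) - P I.card}
  have hU : IsOpen U := by
    simp only [U, Set.ofPred_forall]
    exact isOpen_iInter_of_finite fun K => isOpen_iInter_of_finite fun _ =>
      isOpen_iInter_of_finite fun _ => isOpen_lt (by fun_prop) (by fun_prop)
  refine (unif_pos_of_isOpen hU (x := fun _ => v) (fun K hK hKn => ?_)
    fun _ => ⟨hv0, hv1⟩).trans_le (unif_real_mono fun x hx K hK => ?_)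
  · have h1 := card_le (I ∪ K)
    rw [Finset.card_union_of_disjoint (Finset.disjoint_of_subset_right hK
      Finset.disjoint_sdiff)] at h1
    have h2 := hv K.card (card_le K)
    rw [if_pos ⟨hKn.card_pos, h1⟩] at h2
    simpa using h2
  · rcases K.eq_empty_or_nonempty with rfl | hKn
    · simp
    · rw [sizePrices, sizePrices, Finset.card_union_of_disjoint
        (Finset.disjoint_of_subset_right hK Finset.disjoint_sdiff)]
      exact (hx K hK hKn).le

/-- The upper part contains valuations with equal entries close to one in its interior. -/
lemma unif_real_upperPart_pos {P : ℕ → ℝ} {I : Finset (Fin n)}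
    (h : ∀ j < I.card, P I.card - P j < I.card - j) :
    0 < (unif n).real (upperPart (sizePrices P) I) := by
  obtain ⟨v, hv0, hv1, hv⟩ := exists_mul_lt (c := fun m => if 0 < m ∧ m ≤ I.card then
    (m : ℝ) - (P I.card - P (I.card - m)) else 1) n (fun l => by
      split_ifs with hl
      · have := h (I.card - l) (by omega)
        rw [Nat.cast_sub hl.2] at this
        linarith
      · exact one_pos)
  let U : Set (Fin n → ℝ) := {x | ∀ J : Finset (Fin n), J ⊆ I → J ≠ I →
    P I.card - P J.card < ∑ i ∈ I \ J, x i}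
  have hU : IsOpen U := by
    simp only [U, Set.ofPred_forall]
    exact isOpen_iInter_of_finite fun K => isOpen_iInter_of_finite fun _ =>
      isOpen_iInter_of_finite fun _ => isOpen_lt (by fun_prop) (by fun_prop)
  refine (unif_pos_of_isOpen hU (x := fun _ => 1 - v) (fun J hJ hne => ?_)
    fun _ => ⟨by linarith, by linarith⟩).trans_le (unif_real_mono fun x hx J hJ => ?_)
  · have h1 := Finset.card_lt_card (hJ.ssubset_of_ne hne)
    have h2 := hv (I.card - J.card) ((Nat.sub_le _ _).trans (card_le I))
    rw [if_pos ⟨by omega, by omega⟩, Nat.sub_sub_self h1.le] at h2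
    rw [Finset.sum_const, Finset.card_sdiff_of_subset hJ, nsmul_eq_mul]
    linarith
  · by_cases hne : J = I
    · simp [hne]
    · exact (hx J hJ hne).le

lemma IsConcaveSeq.sub_lt {P : ℕ → ℝ} (hP : IsConcaveSeq n P) (h1 : P 1 < 1) {j k : ℕ}
    (hjk : j < k) (hk : k ≤ n) : P k - P j < k - j := by
  induction k, hjk using Nat.le_induction with
  | base =>
    have := hP.increment_le (show j < n by omega)
    push_cast
    linarith
  | succ k hjk ih =>
    have h2 := ih (by omega)
    have h3 := hP.increment_le (show k < n by omega)
    push_cast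
    linarith

/-- For nondecreasing concave prices with `P 1 < 1`, the bundles with `k < n` items are sold if and
only if `P k < P (k + 1)`. -/
lemma unif_real_optSet_pos {P : ℕ → ℝ} (hP : IsConcaveSeq n P) (hm : IsMonoSeq n P)
    (h1 : P 1 < 1) {I : Finset (Fin n)} (hI : I.card < n → P I.card < P (I.card + 1)) :
    0 < (unif n).real (optSet (sizePrices P) Finset.univ I) := by
  rw [unif_real_optSet hP.isSubmodular (Finset.subset_univ I)]
  refine mul_pos (unif_real_upperPart_pos fun j hj => hP.sub_lt h1 hj (card_le I))
    (unif_real_lowerPart_pos fun l hl hln => ?_)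
  exact (hI (by omega)).trans_le (hm.le hl hln)

lemma unif_real_optSet_eq_zero {P : ℕ → ℝ} (hP : IsConcaveSeq n P) {I : Finset (Fin n)}
    (hI : I.card < n) (h : P (I.card + 1) ≤ P I.card) :
    (unif n).real (optSet (sizePrices P) Finset.univ I) = 0 := by
  rw [unif_real_optSet hP.isSubmodular (Finset.subset_univ I), unif_real_lowerPart_eq_zero hI h,
    mul_zero]

/-- If `P n < P (n - 1)`, the bundles with `n - 1` items are not sold, and normalization forces
`P (n - 1) = P n`. -/
lemma isMonoSeq_of_isNormalized {P : ℕ → ℝ} (hP : IsConcaveSeq n P)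
    (h : IsNormalized (sizePrices P : Prices n)) : IsMonoSeq n P := by
  refine hP.isMonoSeq fun m hm => ?_
  by_contra! hlt
  obtain ⟨I, rfl⟩ := exists_card_eq (n := n) (k := m) (by omega)
  have h0 := (volume_region_eq_zero_iff _ I).2
    (unif_real_optSet_eq_zero hP (by omega) (by rw [hm]; exact hlt.le))
  obtain ⟨J, hJ, hJp⟩ := (h I (ne_univ_iff_card_lt.2 (by omega)) h0).1
  have h1 := Finset.card_lt_card hJ
  have h2 := card_le J
  have h3 : J.card = n := by omega
  simp only [sizePrices, h3] at hJp
  linarith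

lemma isNormalized_of_lt_one {P : ℕ → ℝ} (hP : IsConcaveSeq n P) (hm : IsMonoSeq n P)
    (h1 : P 1 < 1) : IsNormalized (sizePrices P : Prices n) := by
  intro I hI h0
  rw [volume_region_eq_zero_iff] at h0
  have hlt := ne_univ_iff_card_lt.1 hI
  obtain ⟨i, hi⟩ := exists_notMem hlt
  refine ⟨⟨insert i I, Finset.ssubset_insert hi, ?_⟩, ?_⟩
  · rw [sizePrices, sizePrices, Finset.card_insert_of_notMem hi]
    refine le_antisymm ?_ (hm _ hlt)
    by_contra! h
    exact (unif_real_optSet_pos hP hm h1 (fun _ => h)).ne' h0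
  · rintro c ⟨J, hJ, rfl⟩
    exact hm.le_of_subset hJ.subset

lemma eq_succ_of_isNormalized {P : ℕ → ℝ} (hm : IsMonoSeq n P)
    (h : IsNormalized (sizePrices P : Prices n)) {I : Finset (Fin n)} (hI : I.card < n)
    (h0 : volume (region (sizePrices P) I) = 0) : P I.card = P (I.card + 1) := by
  obtain ⟨J, hJ, hJp⟩ := (h I (ne_univ_iff_card_lt.2 hI) h0).1
  refine le_antisymm (hm _ hI) ?_
  rw [sizePrices, sizePrices] at hJp
  rw [← hJp]
  exact hm.le (Finset.card_lt_card hJ) (card_le J)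

/-! ### Uniqueness of critical prices -/

/-- The probability that a buyer who is offered the subsets of `S` only takes nothing. -/
noncomputable def noSale (P : ℕ → ℝ) (S : Finset (Fin n)) : ℝ :=
  (unif n).real (lowerPart (sizePrices P) S ∅)

lemma cubeDeficiency_empty (p : Prices n) : cubeDeficiency p ∅ = 1 := by
  have : upperPart p ∅ = Set.univ := by
    ext x
    simp only [upperPart, Set.mem_ofPred_eq, Set.mem_univ, iff_true, Finset.subset_empty]
    rintro J rfl
    simp
  simp [cubeDeficiency, this]

/-- Summing the balance over all bundles in `S`: the regions fill the cube and each of its faces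
`x_i = 1` with `i ∈ S`. -/
lemma sum_cubeDeficiency {P : ℕ → ℝ} (hP : IsConcaveSeq n P) (h1 : P 1 < 1) (S : Finset (Fin n)) :
    ∑ J ∈ S.powerset, (unif n).real (lowerPart (sizePrices P) S J)
      * cubeDeficiency (sizePrices P) J = 1 - S.card / ((n : ℝ) + 1) := by
  set p : Prices n := sizePrices P with hp
  have hex : ∀ x : Fin n → ℝ, ∃ J ⊆ S, x ∈ optSet p S J := by
    intro x
    obtain ⟨J, hJ, hmax⟩ := Finset.exists_max_image S.powerset (fun J => ∑ j ∈ J, x j - p J)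
      ⟨∅, by simp⟩
    exact ⟨J, Finset.mem_powerset.1 hJ, fun K hK => hmax K (Finset.mem_powerset.2 hK)⟩
  have hvol : ∑ J ∈ S.powerset, (unif n).real (optSet p S J) = 1 := by
    rw [← unif_real_biUnion_optSet p S.powerset fun J hJ => Finset.mem_powerset.1 hJ]
    have : ⋃ J ∈ S.powerset, optSet p S J = Set.univ := by
      ext x
      obtain ⟨J, hJ, hx⟩ := hex x
      simp only [Set.mem_iUnion, Set.mem_univ, iff_true]
      exact ⟨J, Finset.mem_powerset.2 hJ, hx⟩
    rw [this, probReal_univ]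
  have hface : ∀ i ∈ S, ∑ J ∈ S.powerset with i ∈ J,
      (unif n).real {x | Function.update x i 1 ∈ optSet p S J} = 1 := by
    intro i hi
    rw [← unif_real_biUnion_update_optSet p _ (fun J hJ => Finset.mem_powerset.1
      (Finset.mem_filter.1 hJ).1) fun J hJ => (Finset.mem_filter.1 hJ).2]
    have : ⋃ J ∈ S.powerset.filter (fun J => i ∈ J),
        {x | Function.update x i 1 ∈ optSet p S J} = Set.univ := by
      ext x
      obtain ⟨J, hJ, hx⟩ := hex (Function.update x i 1)
      simp only [Set.mem_iUnion, Set.mem_univ, iff_true]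
      refine ⟨J, Finset.mem_filter.2 ⟨Finset.mem_powerset.2 hJ, ?_⟩, hx⟩
      by_contra hiJ
      refine update_notMem_optSet hi hJ hiJ ?_ x hx
      rw [hp, sizePrices, sizePrices, Finset.card_insert_of_notMem hiJ]
      exact (hP.increment_le (card_lt_of_notMem hiJ)).trans_lt h1
    rw [this, probReal_univ]
  have hswap : ∑ J ∈ S.powerset, ∑ i ∈ J,
      (unif n).real {x | Function.update x i 1 ∈ optSet p S J} = S.card := by
    rw [Finset.sum_comm' (t' := S) (s' := fun i => S.powerset.filter fun J => i ∈ J)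
      (by
        intro J i
        simp only [Finset.mem_powerset, Finset.mem_filter]
        exact ⟨fun h => ⟨h, h.1 h.2⟩, fun h => h.1⟩), Finset.sum_congr rfl hface]
    simp
  have hsum : ∑ J ∈ S.powerset, ((n : ℝ) + 1) * ((unif n).real (lowerPart p S J)
      * cubeDeficiency p J) = (n : ℝ) + 1 - S.card := by
    rw [← Finset.sum_congr rfl fun J hJ => optSet_balance hP.isSubmodular
      (Finset.mem_powerset.1 hJ), Finset.sum_sub_distrib, ← Finset.mul_sum, hvol, hswap, mul_one]
  rw [← Finset.mul_sum] at hsum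
  have hn : (n : ℝ) + 1 ≠ 0 := by positivity
  field_simp
  rw [mul_comm]
  exact hsum

/-- If all nonempty bundles in `S` have deficiency zero, or no share in the balance, then nothing
is sold to a buyer interested in `S` only with probability `1 - |S| / (n + 1)`. -/
lemma noSale_eq {P : ℕ → ℝ} (hP : IsConcaveSeq n P) (h1 : P 1 < 1) {S : Finset (Fin n)}
    (hS : ∀ J ⊆ S, J.Nonempty → (unif n).real (lowerPart (sizePrices P) S J)
      * cubeDeficiency (sizePrices P) J = 0) : noSale P S = 1 - S.card / ((n : ℝ) + 1) := by
  rw [← sum_cubeDeficiency hP h1 S, Finset.sum_eq_single ∅, cubeDeficiency_empty, mul_one, noSale]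
  · intro J hJ hne
    exact hS J (Finset.mem_powerset.1 hJ) (Finset.nonempty_iff_ne_empty.2 hne)
  · simp

lemma noSale_le {P : ℕ → ℝ} (hP : IsConcaveSeq n P) (h1 : P 1 < 1) {S : Finset (Fin n)}
    (hS : ∀ J ⊆ S, J.Nonempty → 0 ≤ cubeDeficiency (sizePrices P) J) :
    noSale P S ≤ 1 - S.card / ((n : ℝ) + 1) := by
  have h : (unif n).real (lowerPart (sizePrices P) S ∅) * cubeDeficiency (sizePrices P) ∅ ≤ _ :=
    Finset.single_le_sum (f := fun J => (unif n).real (lowerPart (sizePrices P) S J)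
      * cubeDeficiency (sizePrices P) J) (fun J hJ => mul_nonneg measureReal_nonneg ?_)
      (Finset.empty_mem_powerset S)
  · rw [sum_cubeDeficiency hP h1 S, cubeDeficiency_empty, mul_one] at h
    exact h
  · rcases J.eq_empty_or_nonempty with rfl | hne
    · rw [cubeDeficiency_empty]; exact zero_le_one
    · exact hS J (Finset.mem_powerset.1 hJ) hne

lemma mem_lowerPart_empty {P : ℕ → ℝ} (h0 : P 0 = 0) {S : Finset (Fin n)} {x : Fin n → ℝ} :
    x ∈ lowerPart (sizePrices P) S ∅ ↔ ∀ K ⊆ S, ∑ i ∈ K, x i ≤ P K.card := by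
  simp [lowerPart, sizePrices, h0]

/-- `noSale` is strictly increasing in the price of the largest bundle, since all of the
constraints on a valuation with equal entries follow from the one for the largest bundle. -/
lemma noSale_lt_noSale {P Q : ℕ → ℝ} (hP0 : P 0 = 0) (hQ : IsConcaveSeq n Q) (hQ1 : Q 1 ≤ 1)
    {S : Finset (Fin n)} (hle : ∀ s ≤ S.card, P s ≤ Q s) (hlt : P S.card < Q S.card)
    (hpos : 0 ≤ P S.card) : noSale P S < noSale Q S := by
  have hS : 0 < S.card := by
    by_contra h
    rw [show S.card = 0 by omega, hP0, hQ.zero] at hlt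
    exact lt_irrefl _ hlt
  have hSr : (0 : ℝ) < S.card := by exact_mod_cast hS
  let U : Set (Fin n → ℝ) := {x | (∀ K : Finset (Fin n), K ⊆ S → K.Nonempty →
    ∑ i ∈ K, x i < Q K.card) ∧ P S.card < ∑ i ∈ S, x i}
  have hU : IsOpen U := by
    have : U = {x | ∀ K : Finset (Fin n), K ⊆ S → K.Nonempty → ∑ i ∈ K, x i < Q K.card} ∩
      {x | P S.card < ∑ i ∈ S, x i} := rfl
    rw [this]
    refine IsOpen.inter ?_ (isOpen_lt (by fun_prop) (by fun_prop))
    simp only [Set.ofPred_forall]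
    exact isOpen_iInter_of_finite fun K => isOpen_iInter_of_finite fun _ =>
      isOpen_iInter_of_finite fun _ => isOpen_lt (by fun_prop) (by fun_prop)
  -- the valuation with entries `v` violates the constraint of `P` for `S`, and satisfies all
  -- constraints of `Q`, as `Q` lies above its chords
  set v := (P S.card + Q S.card) / (2 * S.card) with hv
  have hvS : S.card * v = (P S.card + Q S.card) / 2 := by rw [hv]; field_simp
  have hQS := hQ.le_mul (card_le S)
  have hUpos : 0 < (unif n).real U := by
    refine unif_pos_of_isOpen hU (x := fun _ => v) ⟨fun K hK hKn => ?_, ?_⟩ fun _ => ⟨?_, ?_⟩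
    · rw [Finset.sum_const, nsmul_eq_mul]
      have h1 := hQ.chord_le (Finset.card_le_card hK) (card_le S)
      have hKr : (0 : ℝ) < K.card := by exact_mod_cast hKn.card_pos
      refine lt_of_mul_lt_mul_left (a := (S.card : ℝ)) ?_ hSr.le
      calc (S.card : ℝ) * (K.card * v) = K.card * (S.card * v) := by ring
        _ < K.card * Q S.card := by rw [hvS]; exact mul_lt_mul_of_pos_left (by linarith) hKr
        _ ≤ S.card * Q K.card := h1
    · rw [Finset.sum_const, nsmul_eq_mul, hvS]
      linarith
    · rw [hv]
      exact div_pos (by linarith) (by linarith)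
    · refine lt_of_mul_lt_mul_left (a := (S.card : ℝ)) ?_ hSr.le
      rw [hvS]
      nlinarith
  have hdisj : Disjoint (lowerPart (sizePrices P) S ∅) U := by
    rw [Set.disjoint_left]
    intro x hx hxU
    exact absurd ((mem_lowerPart_empty hP0).1 hx S le_rfl) (not_le.2 hxU.2)
  have hsub : lowerPart (sizePrices P) S ∅ ∪ U ⊆ lowerPart (sizePrices Q) S ∅ := by
    rintro x (hx | hx) <;> rw [mem_lowerPart_empty hQ.zero]
    · exact fun K hK => ((mem_lowerPart_empty hP0).1 hx K hK).trans
        (hle _ (Finset.card_le_card hK))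
    · intro K hK
      rcases K.eq_empty_or_nonempty with rfl | hKn
      · simp [hQ.zero]
      · exact (hx.1 K hK hKn).le
  have h1 := unif_real_mono hsub
  rw [measureReal_union hdisj hU.measurableSet] at h1
  simp only [noSale]
  linarith

/-- What criticality with respect to `candidate n k` means for the prices: up to size `k` and for
the grand bundle, they are determined by the probabilities `noSale`. -/
structure IsCriticalSeq (n k : ℕ) (P : ℕ → ℝ) : Prop where
  concave : IsConcaveSeq n P
  mono : IsMonoSeq n P
  lt_one : P 1 < 1
  noSale_eq : ∀ S : Finset (Fin n), S.card ≤ k ∨ S = Finset.univ →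
    noSale P S = 1 - S.card / ((n : ℝ) + 1)
  eq_last : ∀ l, k < l → l ≤ n → P l = P n

lemma isCriticalSeq_of_isCriticalFor {P : ℕ → ℝ} {k : ℕ} (hn : 1 ≤ n) (hk : 1 ≤ k)
    (hP : IsConcaveSeq n P) (hnorm : IsNormalized (sizePrices P : Prices n))
    (h : IsCriticalFor (sizePrices P : Prices n) (candidate n k)) : IsCriticalSeq n k P := by
  have hm := isMonoSeq_of_isNormalized hP hnorm
  -- single items are sold because of `1 ≤ k`
  have h1 : P 1 < 1 := by
    have hpos := (h.1 {⟨0, hn⟩}).2 (Or.inl (by simpa using hk))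
    rw [volume_region_pos_iff] at hpos
    by_contra! h1
    refine hpos.ne' (unif_real_one_le ⟨0, hn⟩ fun x hx => ?_)
    have := hx ∅ (Finset.empty_subset _)
    simp only [sizePrices, Finset.sum_empty, Finset.card_empty, hP.zero, Finset.sum_singleton,
      Finset.card_singleton] at this
    linarith
  have hnull : ∀ J : Finset (Fin n), k < J.card → J.card < n → P J.card = P (J.card + 1) := by
    intro J hJk hJn
    refine eq_succ_of_isNormalized hm hnorm hJn ?_
    by_contra hne
    rcases (h.1 J).1 (pos_iff_ne_zero.2 hne) with hJ | rfl
    · omega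
    · simp at hJn
  refine ⟨hP, hm, h1, fun S hS => noSale_eq hP h1 fun J hJ hJne => ?_, fun l hkl hln => ?_⟩
  -- bundles outside of the candidate family do not contribute, since their lower part is null
  · by_cases hJc : J.card ≤ k ∨ J = Finset.univ
    · have := h.2 J hJc hJne
      rw [deficiency_eq_cubeDeficiency hP.isSubmodular fun K hK => hm.le_of_subset hK] at this
      rw [this, mul_zero]
    · rw [not_or] at hJc
      have hJn := ne_univ_iff_card_lt.1 hJc.2
      rcases hS with hS | rfl
      · exact absurd ((Finset.card_le_card hJ).trans hS) hJc.1
      · rw [unif_real_lowerPart_eq_zero hJn (hnull J (by omega) hJn).ge, zero_mul]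
  · rcases hln.lt_or_eq with hlt | rfl
    · obtain ⟨J, rfl⟩ := exists_card_eq hln
      exact (hP.eq_of_increment_eq_zero hm (hnull J hkl hlt) hlt.le le_rfl).symm
    · rfl

lemma IsCriticalSeq.apply_card_le {k l : ℕ} {P Q : ℕ → ℝ} (hP : IsCriticalSeq n k P)
    (hQ : IsCriticalSeq n l Q) {S : Finset (Fin n)} (hSk : S.card ≤ k ∨ S = Finset.univ)
    (hSl : S.card ≤ l ∨ S = Finset.univ) (hle : ∀ s < S.card, P s ≤ Q s) : Q S.card ≤ P S.card := by
  by_contra! hlt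
  have h := noSale_lt_noSale (S := S) hP.concave.zero hQ.concave hQ.lt_one.le (fun s hs => by
    rcases hs.lt_or_eq with h | rfl
    · exact hle s h
    · exact hlt.le) hlt (by simpa [hP.concave.zero] using hP.mono.le (Nat.zero_le _) (card_le S))
  rw [hP.noSale_eq S hSk, hQ.noSale_eq S hSl] at h
  exact lt_irrefl _ h

lemma IsCriticalSeq.eq_of_le {k l : ℕ} {P Q : ℕ → ℝ} (hP : IsCriticalSeq n k P)
    (hQ : IsCriticalSeq n l Q) {j : ℕ} (hjk : j ≤ k) (hjl : j ≤ l) (hjn : j ≤ n) : P j = Q j := by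
  induction j using Nat.strong_induction_on with
  | _ j ih =>
    obtain ⟨S, rfl⟩ := exists_card_eq hjn
    have h : ∀ s < S.card, P s = Q s := fun s hs => ih s hs (by omega) (by omega) (by omega)
    exact le_antisymm (hQ.apply_card_le hP (Or.inl hjl) (Or.inl hjk) fun s hs => (h s hs).ge)
      (hP.apply_card_le hQ (Or.inl hjk) (Or.inl hjl) fun s hs => (h s hs).le)

lemma IsCriticalSeq.last_le {k : ℕ} {P Q : ℕ → ℝ} (hP : IsCriticalSeq n k P)
    (hQ : IsCriticalSeq n k Q) : Q n ≤ P n := by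
  by_contra! hlt
  refine absurd (hP.apply_card_le hQ (S := Finset.univ) (Or.inr rfl) (Or.inr rfl) fun s hs => ?_)
    (by simpa using hlt)
  rw [Finset.card_univ, Fintype.card_fin] at hs
  by_cases hsk : s ≤ k
  · exact (hP.eq_of_le hQ hsk hsk hs.le).le
  · rw [hP.eq_last s (by omega) hs.le, hQ.eq_last s (by omega) hs.le]
    exact hlt.le

/-- Critical prices are unique. -/
lemma IsCriticalSeq.eq {k : ℕ} {P Q : ℕ → ℝ} (hP : IsCriticalSeq n k P)
    (hQ : IsCriticalSeq n k Q) {j : ℕ} (hj : j ≤ n) : P j = Q j := by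
  by_cases hk : j ≤ k
  · exact hP.eq_of_le hQ hk hk hj
  · rw [hP.eq_last j (by omega) hj, hQ.eq_last j (by omega) hj]
    exact le_antisymm (hQ.last_le hP) (hP.last_le hQ)

lemma IsSJA.unique (hn : 1 ≤ n) {p q : Prices n} (hp : IsSJA p) (hq : IsSJA q) : p = q := by
  obtain ⟨hps, hpn, k, hk, hpk⟩ := hp
  obtain ⟨hqs, hqn, l, hl, hql⟩ := hq
  obtain rfl := hk.unique hl
  obtain ⟨P, rfl, hP⟩ := exists_concaveSeq hps
  obtain ⟨Q, rfl, hQ⟩ := exists_concaveSeq hqs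
  have h1 := isCriticalSeq_of_isCriticalFor hn hk.1.1 hP hpn hpk
  have h2 := isCriticalSeq_of_isCriticalFor hn hk.1.1 hQ hqn hql
  exact funext fun I => h1.eq h2 (card_le I)

/-! ### Deficiencies at optimal schedules -/

lemma comp_mem_upperPart {P : ℕ → ℝ} {I J : Finset (Fin n)} (hIJ : I.card = J.card)
    {e : Equiv.Perm (Fin n)} (he : ∀ i ∈ I, e i ∈ J) {x : Fin n → ℝ}
    (hx : x ∈ upperPart (sizePrices P) J) : (fun i => x (e i)) ∈ upperPart (sizePrices P) I := by
  intro K hK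
  have hmap : I.map e.toEmbedding = J := by
    refine Finset.eq_of_subset_of_card_le (fun j hj => ?_) (by simp [hIJ])
    obtain ⟨i, hi, rfl⟩ := Finset.mem_map.1 hj
    exact he i hi
  have h := hx (K.map e.toEmbedding) (hmap ▸ Finset.map_subset_map.2 hK)
  have h2 : J \ K.map e.toEmbedding = (I \ K).map e.toEmbedding := by
    rw [Finset.map_sdiff, hmap]
  rw [h2, Finset.sum_map] at h
  simpa [sizePrices, hIJ] using h

/-- The deficiency of a bundle depends on its size only. -/
lemma cubeDeficiency_eq_of_card_eq (P : ℕ → ℝ) {I J : Finset (Fin n)} (hIJ : I.card = J.card) :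
    cubeDeficiency (sizePrices P) I = cubeDeficiency (sizePrices P) J := by
  let e₀ : {i // i ∈ I} ≃ {i // i ∈ J} := Finset.equivOfCardEq hIJ
  let e : Equiv.Perm (Fin n) := e₀.extendSubtype
  have he : ∀ i ∈ I, e i ∈ J := fun i hi => e₀.extendSubtype_mem i hi
  have he' : ∀ j ∈ J, e.symm j ∈ I := by
    intro j hj
    by_contra h
    exact e₀.extendSubtype_not_mem _ h (by simpa [e] using hj)
  have hiff : ∀ x : Fin n → ℝ, (fun i => x (e i)) ∈ upperPart (sizePrices P) I ↔
      x ∈ upperPart (sizePrices P) J := by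
    refine fun x => ⟨fun hx => ?_, comp_mem_upperPart hIJ he⟩
    simpa using comp_mem_upperPart hIJ.symm he' hx
  have hI := (isClosed_upperPart (sizePrices P) I).measurableSet
  have h1 : (unif n).real (upperPart (sizePrices P) I)
      = (unif n).real (upperPart (sizePrices P) J) := by
    rw [← (measurePreserving_perm e).measureReal_preimage hI.nullMeasurableSet]
    congr 1
    ext x
    exact hiff x
  have h2 : ∀ i, (unif n).real {x | Function.update x i 1 ∈ upperPart (sizePrices P) I}
      = (unif n).real {x | Function.update x (e i) 1 ∈ upperPart (sizePrices P) J} := by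
    intro i
    have hI' : MeasurableSet {x | Function.update x i 1 ∈ upperPart (sizePrices P) I} :=
      measurable_update_one i 1 hI
    rw [← (measurePreserving_perm e).measureReal_preimage hI'.nullMeasurableSet]
    congr 1
    ext x
    rw [Set.mem_ofPred_eq, ← hiff]
    have : Function.update (fun j => x (e j)) i 1 = fun j => Function.update x (e i) 1 (e j) := by
      ext j
      by_cases hj : j = i
      · subst hj; simp
      · simp [hj]
    rw [← this]
    rfl
  rw [cubeDeficiency, cubeDeficiency, h1, Finset.sum_congr rfl fun i _ => h2 i]
  congr 2
  exact Finset.sum_bij (fun i _ => e i) he (fun i _ j _ h => e.injective h)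
    (fun j hj => ⟨e.symm j, he' j hj, by simp⟩) fun _ _ => rfl

lemma lowerPrice_sizePrices (P : ℕ → ℝ) (k : ℕ) (s : ℝ) :
    lowerPrice (sizePrices P : Prices n) k s = sizePrices (Function.update P k (P k - s)) := by
  ext I
  by_cases h : I.card = k <;> simp [lowerPrice, sizePrices, h]

/-- The rate of change of the revenue has the sign opposite to that of the deficiency, provided that
the lower parts have positive volume. -/
lemma lowerRate_sign {P : ℕ → ℝ} (hP : IsConcaveSeq n P) {I : Finset (Fin n)}
    (h1 : I.card < n → P (I.card + 1) - P I.card < 1)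
    (hpos : ∀ l, I.card < l → l ≤ n → P I.card < P l) :
    (cubeDeficiency (sizePrices P) I < 0 → 0 < lowerRate (sizePrices P : Prices n) I.card) ∧
    (0 < cubeDeficiency (sizePrices P) I → lowerRate (sizePrices P : Prices n) I.card < 0) := by
  have hsum : ∑ J : Finset (Fin n) with J.card = I.card,
      (unif n).real (lowerPart (sizePrices P) Finset.univ J) * cubeDeficiency (sizePrices P) J
      = (∑ J : Finset (Fin n) with J.card = I.card,
        (unif n).real (lowerPart (sizePrices P) Finset.univ J))
        * cubeDeficiency (sizePrices P) I := by
    rw [Finset.sum_mul]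
    refine Finset.sum_congr rfl fun J hJ => ?_
    rw [cubeDeficiency_eq_of_card_eq P (Finset.mem_filter.1 hJ).2]
  have hrate : lowerRate (sizePrices P : Prices n) I.card = -(((n : ℝ) + 1) * _) :=
    lowerRate_eq hP.isSubmodular fun J hJ i hi => by
      rw [sizePrices, sizePrices, Finset.card_insert_of_notMem hi, hJ]
      exact h1 (hJ ▸ card_lt_of_notMem hi)
  have hW : 0 < ∑ J : Finset (Fin n) with J.card = I.card,
      (unif n).real (lowerPart (sizePrices P) Finset.univ J) := by
    refine Finset.sum_pos (fun J hJ => unif_real_lowerPart_pos ?_) ⟨I, by simp⟩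
    rw [(Finset.mem_filter.1 hJ).2]
    exact hpos
  have hn : (0 : ℝ) < n + 1 := by positivity
  rw [hrate, hsum]
  exact ⟨fun h => neg_pos.2 (mul_neg_of_pos_of_neg hn (mul_neg_of_pos_of_neg hW h)),
    fun h => neg_lt_zero.2 (mul_pos hn (mul_pos hW h))⟩

/-- Prices of bundles whose deficiency stays negative should be lowered. Lowering them makes sure
that these bundles are sold. -/
lemma not_isOptimal_of_lower {P : ℕ → ℝ} {I : Finset (Fin n)} {s : ℝ} (hs : 0 < s)
    (hm : IsMonoSeq n P)
    (hP : ∀ σ, 0 < σ → σ ≤ s → IsConcaveSeq n (Function.update P I.card (P I.card - σ)))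
    (h1 : I.card < n → P (I.card + 1) - P I.card + s ≤ 1)
    (hneg : ∀ σ, 0 < σ → σ ≤ s →
      cubeDeficiency (sizePrices (Function.update P I.card (P I.card - σ))) I < 0) :
    ¬ IsOptimal (sizePrices P : Prices n) := by
  intro hopt
  have h := revenue_lt_revenue_lowerPrice (sizePrices P : Prices n) I.card hs fun σ hσ hσs => by
    rw [lowerPrice_sizePrices]
    refine (lowerRate_sign (hP σ hσ hσs.le) (fun hI => ?_) fun l hl hln => ?_).1
      (hneg σ hσ hσs.le)
    · have := h1 hI
      simp
      linarith
    · have := hm.le hl.le hln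
      simp [hl.ne']
      linarith
  rw [lowerPrice_sizePrices] at h
  exact absurd (hopt.2 _ (hP s hs le_rfl).isSymmSubmodular) (not_le.2 h)

/-- Prices of bundles whose deficiency stays positive should be raised, as long as these bundles are
still sold. -/
lemma not_isOptimal_of_raise {P : ℕ → ℝ} {I : Finset (Fin n)} {s : ℝ} (hs : 0 < s)
    (hm : IsMonoSeq n P)
    (hP : ∀ σ, 0 < σ → σ ≤ s → IsConcaveSeq n (Function.update P I.card (P I.card + σ)))
    (h1 : I.card < n → P (I.card + 1) - P I.card < 1)
    (hlt : I.card < n → P I.card + s ≤ P (I.card + 1))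
    (hpos : ∀ σ, 0 < σ → σ ≤ s →
      0 < cubeDeficiency (sizePrices (Function.update P I.card (P I.card + σ))) I) :
    ¬ IsOptimal (sizePrices P : Prices n) := by
  intro hopt
  set Q := Function.update P I.card (P I.card + s) with hQ
  have hQσ : ∀ σ, Function.update Q I.card (Q I.card - σ)
      = Function.update P I.card (P I.card + (s - σ)) := by
    intro σ
    simp [hQ, add_sub_assoc]
  have h := revenue_lowerPrice_lt_revenue (sizePrices Q : Prices n) I.card hs fun σ hσ hσs => by
    rw [lowerPrice_sizePrices, hQσ]
    refine (lowerRate_sign (hP _ (by linarith) (by linarith)) (fun hI => ?_)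
      fun l hl hln => ?_).2 (hpos _ (by linarith) (by linarith))
    · have := h1 hI
      simp
      linarith
    · have h2 := hm.le hl hln
      have h3 := hlt (by omega)
      simp [hl.ne']
      linarith
  rw [lowerPrice_sizePrices, hQσ] at h
  simp only [sub_self, add_zero, Function.update_eq_self] at h
  exact absurd (hopt.2 _ (hP s hs le_rfl).isSymmSubmodular) (not_le.2 h)

lemma IsConcaveSeq.update_lower {P : ℕ → ℝ} (hP : IsConcaveSeq n P) {k : ℕ} {σ : ℝ}
    (hσ : 0 ≤ σ) (h : k + 2 ≤ n → P (k + 2) + P k ≤ 2 * (P (k + 1) - σ)) :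
    IsConcaveSeq n (Function.update P (k + 1) (P (k + 1) - σ)) := by
  refine ⟨by simp [hP.zero], fun j hj => ?_⟩
  have h0 := hP.concave j hj
  by_cases h2 : j = k
  · subst h2
    simpa using h hj
  by_cases h3 : j = k + 1
  · subst h3
    simp
    linarith
  by_cases h4 : j + 1 = k
  · subst h4
    simp [show j ≠ j + 1 + 1 by omega]
    linarith
  · simpa [h2, h3, h4] using h0

lemma IsConcaveSeq.update_raise {P : ℕ → ℝ} (hP : IsConcaveSeq n P) {k : ℕ} {σ : ℝ}
    (hσ : 0 ≤ σ) (hk : k ≠ 0) (ha : k + 2 ≤ n → P (k + 2) + (P k + σ) ≤ 2 * P (k + 1))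
    (hb : ∀ j, j + 2 = k → P k + σ + P j ≤ 2 * P (j + 1)) :
    IsConcaveSeq n (Function.update P k (P k + σ)) := by
  refine ⟨by simp [hP.zero, hk.symm], fun j hj => ?_⟩
  have h0 := hP.concave j hj
  by_cases h2 : j = k
  · subst h2
    simpa using ha hj
  by_cases h3 : j + 1 = k
  · subst h3
    simp
    linarith
  by_cases h4 : j + 2 = k
  · subst h4
    simpa using hb j rfl
  · simpa [h2, h3, h4] using h0

lemma mem_upperPart_update {P : ℕ → ℝ} {I : Finset (Fin n)} {c : ℝ} {x : Fin n → ℝ} :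
    x ∈ upperPart (sizePrices (Function.update P I.card c)) I ↔
      ∀ J, J ⊂ I → c - P J.card ≤ ∑ i ∈ I \ J, x i := by
  constructor
  · intro h J hJ
    have := h J hJ.subset
    simpa [sizePrices, (Finset.card_lt_card hJ).ne] using this
  · intro h J hJ
    rcases hJ.eq_or_ssubset with rfl | hJ
    · simp
    · simpa [sizePrices, (Finset.card_lt_card hJ).ne] using h J hJ

lemma upperPart_update_anti (P : ℕ → ℝ) (I : Finset (Fin n)) {c d : ℝ} (h : c ≤ d) :
    upperPart (sizePrices (Function.update P I.card d)) I
      ⊆ upperPart (sizePrices (Function.update P I.card c)) I := by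
  intro x hx
  rw [mem_upperPart_update] at hx ⊢
  exact fun J hJ => le_trans (by linarith) (hx J hJ)

/-- The volume of the upper part depends continuously on the price, from below. -/
lemma exists_upperPart_lower_lt (P : ℕ → ℝ) (I : Finset (Fin n)) {c : ℝ}
    (h : (unif n).real (upperPart (sizePrices P) I) < c) : ∃ ε > 0, ∀ σ ≤ ε,
      (unif n).real (upperPart (sizePrices (Function.update P I.card (P I.card - σ))) I) < c := by
  let A : ℕ → Set (Fin n → ℝ) := fun m =>
    upperPart (sizePrices (Function.update P I.card (P I.card - 1 / ((m : ℝ) + 1)))) I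
  have hA : Antitone A := fun a b hab => upperPart_update_anti P I (by
    have : 1 / ((b : ℝ) + 1) ≤ 1 / ((a : ℝ) + 1) := by gcongr
    linarith)
  have hInter : ⋂ m, A m = upperPart (sizePrices P) I := by
    ext x
    rw [← Function.update_eq_self I.card P, mem_upperPart_update]
    simp only [A, Set.mem_iInter, mem_upperPart_update]
    constructor
    · intro hx J hJ
      refine le_of_forall_pos_lt_add fun ε hε => ?_
      obtain ⟨m, hm⟩ := exists_nat_one_div_lt hε
      linarith [hx m J hJ]
    · intro hx m J hJ
      have : 0 < 1 / ((m : ℝ) + 1) := by positivity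
      linarith [hx J hJ]
  have htend := tendsto_measure_iInter_atTop (μ := unif n)
    (fun m => (isClosed_upperPart _ _).measurableSet.nullMeasurableSet) hA ⟨0, measure_ne_top _ _⟩
  rw [hInter] at htend
  have htend2 := (ENNReal.tendsto_toReal (measure_ne_top (unif n)
    (upperPart (sizePrices P) I))).comp htend
  obtain ⟨m, hm⟩ := (htend2.eventually_lt_const h).exists
  refine ⟨1 / ((m : ℝ) + 1), by positivity, fun σ hσ => lt_of_le_of_lt ?_ hm⟩
  exact unif_real_mono (upperPart_update_anti P I (by linarith))

/-- The volume of the upper part depends continuously on the price, from above: strict inequalities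
hold up to a null set. -/
lemma exists_lt_upperPart_raise (P : ℕ → ℝ) (I : Finset (Fin n)) {c : ℝ}
    (h : c < (unif n).real (upperPart (sizePrices P) I)) : ∃ ε > 0, ∀ σ ≤ ε,
      c < (unif n).real (upperPart (sizePrices (Function.update P I.card (P I.card + σ))) I) := by
  let A : ℕ → Set (Fin n → ℝ) := fun m =>
    upperPart (sizePrices (Function.update P I.card (P I.card + 1 / ((m : ℝ) + 1)))) I
  have hA : Monotone A := fun a b hab => upperPart_update_anti P I (by
    have : 1 / ((b : ℝ) + 1) ≤ 1 / ((a : ℝ) + 1) := by gcongr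
    linarith)
  let T : Set (Fin n → ℝ) := ⋃ J ∈ I.ssubsets, {x | ∑ i ∈ I \ J, x i = P I.card - P J.card}
  have hT : unif n T = 0 := by
    refine (measure_biUnion_null_iff (Finset.countable_toSet I.ssubsets)).2 fun J hJ => ?_
    have hne : I \ J ≠ ∅ := by
      have := Finset.mem_ssubsets.1 hJ
      simpa [Finset.sdiff_eq_empty_iff_subset] using this.2
    simpa using unif_tie hne (P I.card - P J.card)
  have hUnion : upperPart (sizePrices P) I ⊆ (⋃ m, A m) ∪ T := by
    intro x hx
    rw [← Function.update_eq_self I.card P, mem_upperPart_update] at hx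
    by_cases hxT : x ∈ T
    · exact Or.inr hxT
    left
    have hlt : ∀ J ∈ I.ssubsets, P I.card - P J.card < ∑ i ∈ I \ J, x i := by
      intro J hJ
      have := hx J (Finset.mem_ssubsets.1 hJ)
      refine lt_of_le_of_ne this fun he => hxT ?_
      exact Set.mem_biUnion hJ he.symm
    have hev : ∀ᶠ m : ℕ in Filter.atTop, ∀ J ∈ I.ssubsets,
        1 / ((m : ℝ) + 1) < ∑ i ∈ I \ J, x i - (P I.card - P J.card) := by
      rw [Filter.eventually_all_finset]
      exact fun J hJ => tendsto_one_div_add_atTop_nhds_zero_nat.eventually_lt_const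
        (sub_pos.2 (hlt J hJ))
    obtain ⟨m, hm⟩ := hev.exists
    refine Set.mem_iUnion.2 ⟨m, mem_upperPart_update.2 fun J hJ => ?_⟩
    linarith [hm J (Finset.mem_ssubsets.2 hJ)]
  have hle : unif n (upperPart (sizePrices P) I) ≤ unif n (⋃ m, A m) := by
    refine (measure_mono hUnion).trans ((measure_union_le _ _).trans ?_)
    rw [hT, add_zero]
  have hle2 : (unif n).real (upperPart (sizePrices P) I) ≤ (unif n).real (⋃ m, A m) :=
    ENNReal.toReal_mono (measure_ne_top _ _) hle
  have htend2 := (ENNReal.tendsto_toReal (measure_ne_top (unif n) (⋃ m, A m))).comp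
    (tendsto_measure_iUnion_atTop (μ := unif n) hA)
  obtain ⟨m, hm⟩ := (htend2.eventually_const_lt (h.trans_le hle2)).exists
  refine ⟨1 / ((m : ℝ) + 1), by positivity, fun σ hσ => lt_of_lt_of_le hm ?_⟩
  exact unif_real_mono (upperPart_update_anti P I (by linarith))

lemma exists_pos_of_imp {q : Prop} {c : ℝ} (h : q → 0 < c) : ∃ s > 0, q → s ≤ c := by
  by_cases hq : q
  · exact ⟨c, h hq, fun _ => le_rfl⟩
  · exact ⟨1, one_pos, fun h => absurd h hq⟩

lemma sum_face_mono {p q : Prices n} {I : Finset (Fin n)} (h : upperPart p I ⊆ upperPart q I) :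
    ∑ i ∈ I, (unif n).real {x | Function.update x i 1 ∈ upperPart p I}
      ≤ ∑ i ∈ I, (unif n).real {x | Function.update x i 1 ∈ upperPart q I} :=
  Finset.sum_le_sum fun _ _ => unif_real_mono fun _ hx => h hx

/-- If the price of `I` may be lowered within the submodular schedules, then an optimal schedule
has nonnegative deficiency at `I`. -/
lemma cubeDeficiency_nonneg {P : ℕ → ℝ} (hP : IsConcaveSeq n P) (hm : IsMonoSeq n P)
    (h1 : P 1 < 1) (hopt : IsOptimal (sizePrices P : Prices n)) {I : Finset (Fin n)}
    (hI : I.Nonempty) (hR : ¬ IsRightTight (sizePrices P) I) :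
    0 ≤ cubeDeficiency (sizePrices P) I := by
  by_contra! hneg
  obtain ⟨k, hk⟩ : ∃ k, I.card = k + 1 := ⟨I.card - 1, by have := hI.card_pos; omega⟩
  rw [cubeDeficiency, sub_neg] at hneg
  obtain ⟨ε, hε, hε'⟩ := exists_upperPart_lower_lt P I hneg
  -- concavity at `k + 1` is strict, which leaves room for a lower price
  obtain ⟨s₁, hs₁, hs₁'⟩ := exists_pos_of_imp (q := k + 2 ≤ n)
    (c := (2 * P (k + 1) - P (k + 2) - P k) / 2) fun hkn => by
      have h2 := hP.concave k hkn
      have h3 : P (k + 2) + P k ≠ 2 * P (k + 1) := fun h => hR (isRightTight_of_eq hk hkn h)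
      have := lt_of_le_of_ne h2 h3
      linarith
  obtain ⟨s₂, hs₂, hs₂'⟩ := exists_pos_of_imp (q := I.card < n)
    (c := 1 - (P (I.card + 1) - P I.card)) fun hlt => by
      have := hP.increment_le hlt
      linarith
  refine not_isOptimal_of_lower (I := I) (s := min ε (min s₁ s₂)) (lt_min hε (lt_min hs₁ hs₂)) hm
    (fun σ hσ hσs => ?_) (fun hlt => ?_) (fun σ hσ hσs => ?_) hopt
  · rw [hk]
    refine hP.update_lower hσ.le fun hkn => ?_
    have h2 := hs₁' hkn
    have h3 : σ ≤ s₁ := hσs.trans ((min_le_right _ _).trans (min_le_left _ _))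
    linarith
  · have h2 := hs₂' hlt
    have h3 : min ε (min s₁ s₂) ≤ s₂ := (min_le_right _ _).trans (min_le_right _ _)
    linarith
  -- the faces only grow when the price is lowered
  · rw [cubeDeficiency, sub_neg]
    refine (hε' σ (hσs.trans (min_le_left _ _))).trans_le ?_
    gcongr 1 / ((n : ℝ) + 1) * ?_
    refine sum_face_mono ?_
    have := upperPart_update_anti P I (show P I.card - σ ≤ P I.card by linarith)
    rwa [Function.update_eq_self] at this

/-- If the price of `I` may be raised within the submodular schedules, then an optimal schedule
has nonpositive deficiency at `I`. -/
lemma cubeDeficiency_nonpos {P : ℕ → ℝ} (hP : IsConcaveSeq n P) (hm : IsMonoSeq n P)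
    (h1 : P 1 < 1) (hopt : IsOptimal (sizePrices P : Prices n)) {I : Finset (Fin n)}
    (hI : I.Nonempty) (hL : ¬ IsLeftTight (sizePrices P) I)
    (hsold : I.card < n → P I.card < P (I.card + 1)) :
    cubeDeficiency (sizePrices P) I ≤ 0 := by
  by_contra! hpos
  rw [cubeDeficiency, sub_pos] at hpos
  obtain ⟨ε, hε, hε'⟩ := exists_lt_upperPart_raise P I hpos
  -- concavity next to `|I|` is strict on both sides, which leaves room for a higher price
  obtain ⟨s₁, hs₁, hs₁'⟩ := exists_pos_of_imp (q := I.card + 2 ≤ n)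
    (c := 2 * P (I.card + 1) - P (I.card + 2) - P I.card) fun hkn => by
      have h2 := hP.concave I.card hkn
      have h3 : P (I.card + 2) + P I.card ≠ 2 * P (I.card + 1) :=
        fun h => hL (isLeftTight_of_eq_above hkn h)
      have := lt_of_le_of_ne h2 h3
      linarith
  obtain ⟨s₂, hs₂, hs₂'⟩ := exists_pos_of_imp (q := 2 ≤ I.card)
    (c := 2 * P (I.card - 1) - P I.card - P (I.card - 2)) fun h2 => by
      obtain ⟨j, hj⟩ : ∃ j, I.card = j + 2 := ⟨I.card - 2, by omega⟩
      have h2 := hP.concave j (hj ▸ card_le I)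
      have h3 : P (j + 2) + P j ≠ 2 * P (j + 1) := fun h => hL (isLeftTight_of_eq_below hj h)
      have := lt_of_le_of_ne h2 h3
      rw [hj]
      simp only [Nat.add_sub_cancel, show j + 2 - 1 = j + 1 by omega]
      linarith
  obtain ⟨s₃, hs₃, hs₃'⟩ := exists_pos_of_imp (q := I.card < n)
    (c := P (I.card + 1) - P I.card) fun hlt => sub_pos.2 (hsold hlt)
  set s := min (min ε s₁) (min s₂ s₃) with hs
  have hsε : s ≤ ε := (min_le_left _ _).trans (min_le_left _ _)
  have hss₁ : s ≤ s₁ := (min_le_left _ _).trans (min_le_right _ _)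
  have hss₂ : s ≤ s₂ := (min_le_right _ _).trans (min_le_left _ _)
  have hss₃ : s ≤ s₃ := (min_le_right _ _).trans (min_le_right _ _)
  refine not_isOptimal_of_raise (I := I) (s := s) (lt_min (lt_min hε hs₁) (lt_min hs₂ hs₃)) hm
    (fun σ hσ hσs => ?_) (fun hlt => ?_) (fun hlt => ?_) (fun σ hσ hσs => ?_) hopt
  · refine hP.update_raise hσ.le hI.card_pos.ne' (fun hkn => ?_) fun j hj => ?_
    · linarith [hs₁' hkn]
    · have h2 := hs₂' (by omega)
      rw [← hj] at h2 ⊢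
      simp only [Nat.add_sub_cancel, show j + 2 - 1 = j + 1 by omega] at h2
      linarith
  · linarith [hP.increment_le hlt]
  · linarith [hs₃' hlt]
  -- the faces only shrink when the price is raised
  · rw [cubeDeficiency, sub_pos]
    refine lt_of_le_of_lt ?_ (hε' σ (hσs.trans hsε))
    gcongr 1 / ((n : ℝ) + 1) * ?_
    refine sum_face_mono ?_
    have := upperPart_update_anti P I (show P I.card ≤ P I.card + σ by linarith)
    rwa [Function.update_eq_self] at this

/-! ### Existence of optimal schedules -/

lemma unif_real_coord (i : Fin n) {s : Set ℝ} (hs : MeasurableSet s) :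
    (unif n).real {x | x i ∈ s} = volume.real (s ∩ Set.Icc 0 1) := by
  have hmp : MeasurePreserving (Function.eval i) (unif n) (volume.restrict (Set.Icc (0 : ℝ) 1)) :=
    measurePreserving_eval _ i
  rw [← measureReal_restrict_apply hs, ← hmp.measureReal_preimage hs.nullMeasurableSet]
  rfl

lemma measurableSet_coord_Icc (i : Fin n) (a b : ℝ) :
    MeasurableSet {x : Fin n → ℝ | x i ∈ Set.Icc a b} := measurable_pi_apply i measurableSet_Icc

lemma unif_real_coord_Icc_le (i : Fin n) {a b : ℝ} (hab : a ≤ b) :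
    (unif n).real {x | x i ∈ Set.Icc a b} ≤ b - a := by
  rw [unif_real_coord i measurableSet_Icc]
  refine (measureReal_mono Set.inter_subset_left (by simp)).trans ?_
  simp [hab]

/-- If the last item of `I` costs nearly one, then the upper part is a thin slab compared to its
face, so that the deficiency is negative. -/
lemma cubeDeficiency_neg_of_thin {P : ℕ → ℝ} {I : Finset (Fin n)} {k : ℕ} (hk : I.card = k + 1)
    {σ : ℝ} (h0 : 0 ≤ σ) (hσ : σ < 1 / ((n : ℝ) + 1)) (hP : 1 - σ ≤ P (k + 1) - P k)
    (hpos : ∀ j < I.card, P I.card - P j < I.card - j) :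
    cubeDeficiency (sizePrices P) I < 0 := by
  obtain ⟨i, hi⟩ : I.Nonempty := Finset.card_pos.1 (by omega)
  have hV := unif_real_upperPart_pos hpos
  have hm : MeasurableSet {x | Function.update x i 1 ∈ upperPart (sizePrices P) I} :=
    measurable_update_one i 1 (isClosed_upperPart (sizePrices P) I).measurableSet
  set F := (unif n).real {x | Function.update x i 1 ∈ upperPart (sizePrices P) I} with hF
  have hle : (unif n).real (upperPart (sizePrices P) I) ≤ σ * F := by
    have hsub : (unif n).real (upperPart (sizePrices P) I) ≤ (unif n).real
        ({x | x i ∈ Set.Icc (1 - σ) 1}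
          ∩ {x | Function.update x i 1 ∈ upperPart (sizePrices P) I}) := by
      rw [unif_real_congr (A := upperPart (sizePrices P) I)
        (B := upperPart (sizePrices P) I ∩ cube n) fun x hx => ⟨fun h => ⟨h, hx⟩, fun h => h.1⟩]
      refine unif_real_mono fun x hx => ⟨?_, ?_⟩
      · refine ⟨?_, (mem_cube.1 hx.2 i).2⟩
        have := hx.1 (I.erase i) (Finset.erase_subset i I)
        rw [Finset.sdiff_erase_self hi, Finset.sum_singleton, sizePrices, sizePrices,
          Finset.card_erase_of_mem hi, hk, Nat.add_sub_cancel] at this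
        exact hP.trans this
      · refine upperPart_mono (fun j _ => ?_) hx.1
        by_cases hj : j = i
        · subst hj; simpa using (mem_cube.1 hx.2 j).2
        · simp [hj]
    rw [unif_real_inter {i} (measurableSet_coord_Icc i _ _) hm
      (fun x y h hx => by
        have := h i (Finset.mem_singleton_self i)
        simp only [Set.mem_ofPred_eq] at hx ⊢
        rwa [← this])
      (fun x y h hx => by
        have : Function.update x i 1 = Function.update y i 1 := by
          ext j
          by_cases hj : j = i
          · subst hj; simp
          · simpa [hj] using h j (by simpa using hj)
        simp only [Set.mem_ofPred_eq] at hx ⊢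
        rwa [← this])] at hsub
    refine hsub.trans (mul_le_mul_of_nonneg_right ?_ measureReal_nonneg)
    simpa using unif_real_coord_Icc_le i (show 1 - σ ≤ 1 by linarith)
  have hFpos : 0 < F := by
    by_contra! h
    nlinarith
  have hsum : F ≤ ∑ j ∈ I, (unif n).real {x | Function.update x j 1 ∈ upperPart (sizePrices P) I} :=
    Finset.single_le_sum (f := fun j => (unif n).real
      {x | Function.update x j 1 ∈ upperPart (sizePrices P) I}) (fun _ _ => measureReal_nonneg) hi
  have h1 : 1 / ((n : ℝ) + 1) * F ≤ 1 / ((n : ℝ) + 1) *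
      ∑ j ∈ I, (unif n).real {x | Function.update x j 1 ∈ upperPart (sizePrices P) I} := by
    gcongr
  have h2 : σ * F < 1 / ((n : ℝ) + 1) * F := mul_lt_mul_of_pos_right hσ hFpos
  rw [cubeDeficiency]
  linarith

/-- Prices above the value of the bundle may be lowered to it without an effect. -/
lemma revenue_min_card {P : ℕ → ℝ} (h0 : P 0 = 0) :
    revenue (sizePrices (fun k => min (P k) k) : Prices n) = revenue (sizePrices P : Prices n) := by
  refine revenue_congr fun x hx => le_antisymm (util_le fun J => ?_) (util_le fun J => ?_)
  · have h1 := le_util (sizePrices P) x J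
    have h2 := le_util (sizePrices P) x ∅
    have h3 : ∑ j ∈ J, x j ≤ J.card := by
      have := Finset.sum_le_sum fun j (_ : j ∈ J) => (mem_cube.1 hx j).2
      simpa using this
    simp only [sizePrices, Finset.sum_empty, Finset.card_empty, h0] at h1 h2 ⊢
    rcases min_choice (P J.card) (J.card : ℝ) with h | h <;> rw [h] <;> linarith
  · have h1 := le_util (sizePrices fun k => min (P k) k) x J
    have h2 := min_le_left (P J.card) (J.card : ℝ)
    simp only [sizePrices] at h1 ⊢
    linarith

/-- Prices above the price of the grand bundle may be lowered to it without an effect. -/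
lemma revenue_min_last (P : ℕ → ℝ) :
    revenue (sizePrices (fun k => min (P k) (P n)) : Prices n)
      = revenue (sizePrices P : Prices n) := by
  refine revenue_congr fun x hx => le_antisymm (util_le fun J => ?_) (util_le fun J => ?_)
  · have h1 := le_util (sizePrices P) x J
    have h2 := le_util (sizePrices P) x Finset.univ
    have h3 : ∑ j ∈ J, x j ≤ ∑ j, x j :=
      Finset.sum_le_sum_of_subset_of_nonneg (Finset.subset_univ J)
        fun j _ _ => (mem_cube.1 hx j).1
    simp only [sizePrices, Finset.card_univ, Fintype.card_fin] at h1 h2 ⊢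
    rcases min_choice (P J.card) (P n) with h | h <;> rw [h] <;> linarith
  · have h1 := le_util (sizePrices fun k => min (P k) (P n)) x J
    have h2 := min_le_left (P J.card) (P n)
    simp only [sizePrices] at h1 ⊢
    linarith

lemma IsConcaveSeq.min_card {P : ℕ → ℝ} (hP : IsConcaveSeq n P) :
    IsConcaveSeq n fun k => min (P k) k := by
  refine ⟨by simp [hP.zero], fun k hk => ?_⟩
  have h := hP.concave k hk
  have h1 := min_le_left (P (k + 2)) ((k + 2 : ℕ) : ℝ)
  have h2 := min_le_right (P (k + 2)) ((k + 2 : ℕ) : ℝ)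
  have h3 := min_le_left (P k) (k : ℝ)
  have h4 := min_le_right (P k) (k : ℝ)
  rcases min_choice (P (k + 1)) ((k + 1 : ℕ) : ℝ) with h5 | h5 <;> rw [h5] <;> push_cast at * <;>
    linarith

lemma IsConcaveSeq.min_last {P : ℕ → ℝ} (hP : IsConcaveSeq n P) (h0 : 0 ≤ P n) :
    IsConcaveSeq n fun k => min (P k) (P n) := by
  refine ⟨by simp [hP.zero, h0], fun k hk => ?_⟩
  have h := hP.concave k hk
  have h1 := min_le_left (P (k + 2)) (P n)
  have h2 := min_le_right (P (k + 2)) (P n)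
  have h3 := min_le_left (P k) (P n)
  have h4 := min_le_right (P k) (P n)
  rcases min_choice (P (k + 1)) (P n) with h5 | h5 <;> rw [h5] <;> linarith

lemma IsConcaveSeq.isMonoSeq_min_last {P : ℕ → ℝ} (hP : IsConcaveSeq n P) (h0 : 0 ≤ P n) :
    IsMonoSeq n fun k => min (P k) (P n) :=
  (hP.min_last h0).isMonoSeq fun m _ => by simp

lemma IsMonoSeq.min_card {P : ℕ → ℝ} (hP : IsMonoSeq n P) : IsMonoSeq n fun k => min (P k) k :=
  fun k hk => min_le_min (hP k hk) (by push_cast; linarith)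

/-- Otherwise let `r` be maximal such that bundles with `r` items are not sold since they cost at
least `r`. Lowering their price slightly below `r` increases the revenue. -/
lemma lt_one_of_isOptimal (hn : 1 ≤ n) {P : ℕ → ℝ} (hP : IsConcaveSeq n P) (hm : IsMonoSeq n P)
    (hopt : IsOptimal (sizePrices P : Prices n)) : P 1 < 1 := by
  by_contra! h1
  -- the equivalent schedule `Q` has increments `1` up to `r` and a smaller one after it, so that
  -- its price at `r` may be lowered
  set Q : ℕ → ℝ := fun k => min (P k) k with hQdef
  have hQ : IsConcaveSeq n Q := hP.min_card
  have hQopt : IsOptimal (sizePrices Q : Prices n) :=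
    ⟨hQ.isSymmSubmodular, fun q hq => (hopt.2 q hq).trans (revenue_min_card hP.zero).ge⟩
  obtain ⟨r, hr, hmax⟩ := Finset.exists_max_image
    ((Finset.range (n + 1)).filter fun r : ℕ => (r : ℝ) ≤ P r) id
    ⟨1, by simp [h1, show 0 < n from hn]⟩
  simp only [Finset.mem_filter, Finset.mem_range, id, and_imp] at hr hmax
  obtain ⟨hrn, hrP⟩ := hr
  have hr1 : 1 ≤ r := hmax 1 (by omega) (by simpa using h1)
  obtain ⟨k, rfl⟩ : ∃ k, r = k + 1 := ⟨r - 1, by omega⟩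
  have hQle : ∀ j ≤ k + 1, Q j = j := by
    intro j hj
    refine min_eq_right ?_
    have h2 := hP.chord_le hj (show k + 1 ≤ n by omega)
    have h3 : (j : ℝ) * (k + 1 : ℕ) ≤ j * P (k + 1) := by gcongr
    have h4 : (0 : ℝ) < (k + 1 : ℕ) := by positivity
    refine le_of_mul_le_mul_left ?_ h4
    linarith
  have hQlt : k + 2 ≤ n → 0 < ((k + 2 : ℕ) - Q (k + 2)) / 2 := by
    intro hkn
    have h2 : P (k + 2) < (k + 2 : ℕ) := by
      by_contra! h
      have := hmax (k + 2) (by omega) h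
      omega
    have := min_le_left (P (k + 2)) ((k + 2 : ℕ) : ℝ)
    simp only [hQdef]
    linarith
  obtain ⟨s₁, hs₁, hs₁'⟩ := exists_pos_of_imp hQlt
  have hn0 : 0 < 1 / (2 * ((n : ℝ) + 1)) := by positivity
  have hn1 : 1 / (2 * ((n : ℝ) + 1)) < 1 / ((n : ℝ) + 1) := by
    apply one_div_lt_one_div_of_lt <;> linarith [Nat.cast_nonneg (α := ℝ) n]
  obtain ⟨I, hI⟩ := exists_card_eq (n := n) (k := k + 1) (by omega)
  have hk1 := hQle (k + 1) le_rfl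
  have hk0 := hQle k (by omega)
  push_cast at hk1
  refine not_isOptimal_of_lower (P := Q) (I := I) (s := min s₁ (1 / (2 * ((n : ℝ) + 1))))
    (lt_min hs₁ hn0) hm.min_card (fun σ hσ hσs => ?_) (fun hlt => ?_) (fun σ hσ hσs => ?_) hQopt
  · rw [hI]
    refine hQ.update_lower hσ.le fun hkn => ?_
    have h2 := hs₁' hkn
    have h3 := hσs.trans (min_le_left _ _)
    push_cast at h2
    rw [hk0, hk1]
    linarith
  · rw [hI] at hlt ⊢
    have h2 := hs₁' hlt
    have h3 := min_le_left s₁ (1 / (2 * ((n : ℝ) + 1)))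
    push_cast at h2
    change Q (k + 2) - Q (k + 1) + _ ≤ 1
    rw [hk1]
    linarith
  · have h3 := hσs.trans (min_le_right _ _)
    refine cubeDeficiency_neg_of_thin hI hσ.le (h3.trans_lt hn1) ?_ fun j hj => ?_
    · rw [hI, Function.update_self, Function.update_of_ne (by omega), hk1, hk0]
      linarith
    · rw [Function.update_self, Function.update_of_ne hj.ne, hI, hQle j (by omega), hk1]
      push_cast
      linarith

/-- The schedule that charges one half for every nonempty bundle. -/
noncomputable def halfPrice (k : ℕ) : ℝ := if k = 0 then 0 else 1 / 2

lemma isConcaveSeq_halfPrice : IsConcaveSeq n halfPrice := by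
  refine ⟨by simp [halfPrice], fun k _ => ?_⟩
  by_cases h : k = 0 <;> norm_num [halfPrice, h]

lemma revenue_halfPrice_pos (hn : 1 ≤ n) : 0 < revenue (sizePrices halfPrice : Prices n) := by
  have h0 : ∀ I : Finset (Fin n), 0 ≤ (sizePrices halfPrice : Prices n) I := by
    intro I
    simp only [sizePrices, halfPrice]
    split_ifs <;> norm_num
  refine Finset.sum_pos' (fun I _ => mul_nonneg (h0 I) measureReal_nonneg)
    ⟨Finset.univ, Finset.mem_univ _, mul_pos ?_ ?_⟩
  · simp [sizePrices, halfPrice, show n ≠ 0 by omega]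
  · rw [volume_real_region]
    refine unif_real_optSet_pos isConcaveSeq_halfPrice (fun k _ => ?_) ?_ fun h => ?_
    · by_cases h : k = 0 <;> simp [halfPrice, h]
    · norm_num [halfPrice]
    · simp at h

lemma revenue_nonpos_of_nonpos {p : Prices n}
    (h : ∀ I, p I ≤ 0 ∨ volume.real (region p I) = 0) : revenue p ≤ 0 := by
  refine Finset.sum_nonpos fun I _ => ?_
  rcases h I with h | h
  · exact mul_nonpos_of_nonpos_of_nonneg h measureReal_nonneg
  · rw [h, mul_zero]

/-- If the grand bundle has a negative price, no bundle with a positive price is sold. -/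
lemma revenue_nonpos_of_last_neg {P : ℕ → ℝ} (h : P n < 0) :
    revenue (sizePrices P : Prices n) ≤ 0 := by
  refine revenue_nonpos_of_nonpos fun I => ?_
  by_cases hI : (sizePrices P : Prices n) I ≤ 0
  · exact Or.inl hI
  · right
    push Not at hI
    have : region (sizePrices P : Prices n) I = ∅ := by
      refine Set.eq_empty_of_forall_notMem fun x hx => ?_
      have h1 := hx.2 Finset.univ
      have h2 : ∑ j ∈ I, x j ≤ ∑ j, x j :=
        Finset.sum_le_sum_of_subset_of_nonneg (Finset.subset_univ I) fun j _ _ => (hx.1 j).1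
      simp only [sizePrices, Finset.card_univ, Fintype.card_fin] at h1 hI
      linarith
    simp [this]

lemma IsOptimal.revenue_pos (hn : 1 ≤ n) {p : Prices n} (h : IsOptimal p) : 0 < revenue p :=
  (revenue_halfPrice_pos hn).trans_le (h.2 _ isConcaveSeq_halfPrice.isSymmSubmodular)

/-- Every revenue can be achieved with prices in `[0, n]`. -/
lemma exists_bounded_revenue_le {q : Prices n} (hq : IsSymmSubmodular q) :
    ∃ p : Prices n, IsSymmSubmodular p ∧ (∀ I, p I ∈ Set.Icc (0 : ℝ) n) ∧
      revenue q ≤ revenue p := by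
  obtain ⟨P, rfl, hP⟩ := exists_concaveSeq hq
  rcases lt_or_ge (P n) 0 with hneg | h0
  · refine ⟨sizePrices fun _ => 0, IsConcaveSeq.isSymmSubmodular ⟨rfl, by simp⟩,
      fun I => by simp [sizePrices], (revenue_nonpos_of_last_neg hneg).trans ?_⟩
    simp [revenue, sizePrices]
  · have hQ := hP.min_last h0
    refine ⟨sizePrices fun k => min (min (P k) (P n)) k, hQ.min_card.isSymmSubmodular,
      fun I => ⟨?_, ?_⟩, ?_⟩
    · have := (hP.isMonoSeq_min_last h0).min_card.le (Nat.zero_le I.card) (card_le I)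
      simpa [hP.zero, h0, sizePrices] using this
    · refine (min_le_right _ _).trans ?_
      exact_mod_cast card_le I
    · rw [revenue_min_card (P := fun k => min (P k) (P n)) (by simp [hP.zero, h0]),
        revenue_min_last P]

lemma exists_isOptimal : ∃ p : Prices n, IsOptimal p := by
  let K : Set (Prices n) := {p | IsSymmSubmodular p} ∩ Set.univ.pi fun _ => Set.Icc (0 : ℝ) n
  have hclosed : IsClosed {p : Prices n | IsSymmSubmodular p} := by
    have : {p : Prices n | IsSymmSubmodular p} = {p | p ∅ = 0} ∩
        ((⋂ I, ⋂ J, {p | p (I ∪ J) + p (I ∩ J) ≤ p I + p J}) ∩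
        ⋂ I, ⋂ J, ⋂ _ : I.card = J.card, {p | p I = p J}) := by
      ext p
      simp [IsSymmSubmodular, IsSubmodular, IsSymmetric]
    rw [this]
    refine (isClosed_eq (by fun_prop) (by fun_prop)).inter (IsClosed.inter ?_ ?_)
    · exact isClosed_iInter fun I => isClosed_iInter fun J =>
        isClosed_le (by fun_prop) (by fun_prop)
    · exact isClosed_iInter fun I => isClosed_iInter fun J => isClosed_iInter fun _ =>
        isClosed_eq (by fun_prop) (by fun_prop)
  have hK : IsCompact K := (isCompact_univ_pi fun _ => isCompact_Icc).inter_left hclosed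
  have hne : K.Nonempty := by
    refine ⟨sizePrices fun _ => 0, IsConcaveSeq.isSymmSubmodular ⟨rfl, by simp⟩, ?_⟩
    simp [sizePrices, Pi.le_def]
  obtain ⟨p, hp, hmax⟩ := hK.exists_isMaxOn hne continuous_revenue.continuousOn
  refine ⟨p, hp.1, fun q hq => ?_⟩
  obtain ⟨q', hq', hb, hle⟩ := exists_bounded_revenue_le hq
  exact hle.trans (hmax ⟨hq', fun I _ => hb I⟩)

lemma exists_isNormalized_isOptimal (hn : 1 ≤ n) :
    ∃ p : Prices n, IsNormalized p ∧ IsOptimal p := by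
  obtain ⟨p, hp⟩ := exists_isOptimal (n := n)
  obtain ⟨P, rfl, hP⟩ := exists_concaveSeq hp.1
  have h0 : 0 ≤ P n := by
    by_contra! h
    exact absurd (hp.revenue_pos hn) (not_lt.2 (revenue_nonpos_of_last_neg h))
  have hQ := hP.min_last h0
  have hm := hP.isMonoSeq_min_last h0
  have hopt : IsOptimal (sizePrices (fun k => min (P k) (P n)) : Prices n) :=
    ⟨hQ.isSymmSubmodular, fun q hq => (hp.2 q hq).trans (revenue_min_last P).ge⟩
  exact ⟨_, isNormalized_of_lt_one hQ hm (lt_one_of_isOptimal hn hQ hm hopt), hopt⟩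

/-! ### Nondegenerate optimal schedules are straight-jacket auctions -/

lemma lt_succ_of_volume_pos {P : ℕ → ℝ} (hP : IsConcaveSeq n P) {I : Finset (Fin n)}
    (h : 0 < volume (region (sizePrices P) I)) (hI : I.card < n) :
    P I.card < P (I.card + 1) := by
  by_contra! hle
  rw [volume_region_pos_iff, unif_real_optSet_eq_zero hP hI hle] at h
  exact lt_irrefl _ h

lemma satisfiesCriticalConditions_of_isOptimal (hn : 1 ≤ n) {P : ℕ → ℝ} (hP : IsConcaveSeq n P)
    (hm : IsMonoSeq n P) (hopt : IsOptimal (sizePrices P : Prices n)) :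
    SatisfiesCriticalConditions (sizePrices P : Prices n) := by
  intro I hI
  have h1 := lt_one_of_isOptimal hn hP hm hopt
  rw [deficiency_eq_cubeDeficiency hP.isSubmodular fun J hJ => hm.le_of_subset hJ]
  have hnonneg := cubeDeficiency_nonneg hP hm h1 hopt hI
  have hnonpos := fun hL hpos => cubeDeficiency_nonpos hP hm h1 hopt hI hL
    (lt_succ_of_volume_pos hP hpos)
  exact ⟨fun hL hR hpos => le_antisymm (hnonpos hL hpos) (hnonneg hR), fun _ hR _ => hnonneg hR,
    fun _ hR => hnonneg hR, fun _ hL hpos => hnonpos hL hpos⟩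

lemma IsConcaveSeq.one_pos_of_isOptimal (hn : 1 ≤ n) {P : ℕ → ℝ} (hP : IsConcaveSeq n P)
    (hopt : IsOptimal (sizePrices P : Prices n)) : 0 < P 1 := by
  by_contra! h
  refine absurd (hopt.revenue_pos hn) (not_lt.2 (revenue_nonpos_of_nonpos fun I => Or.inl ?_))
  exact (hP.le_mul (card_le I)).trans (mul_nonpos_of_nonneg_of_nonpos (Nat.cast_nonneg _) h)

/-- With two items, pure bundling at a price `c ≤ 2 / 3` sells with probability more than `2 / 3`:
the triangle `x₀ + x₁ ≤ c` is covered by three boxes of total area `2 c² / 3`. -/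
lemma noSale_two_lt {P : ℕ → ℝ} (h0 : P 0 = 0) (h12 : P 1 = P 2) (hpos : 0 < P 1)
    (hle : P 1 ≤ 2 / 3) : noSale P (Finset.univ : Finset (Fin 2)) < 1 / 3 := by
  set c := P 1 with hc
  let B (a b d : ℝ) : Set (Fin 2 → ℝ) := {x | x 0 ∈ Set.Icc a b} ∩ {x | x 1 ∈ Set.Icc 0 d}
  have hB : ∀ a b d, a ≤ b → 0 ≤ d → (unif 2).real (B a b d) ≤ (b - a) * d := by
    intro a b d hab hd
    rw [unif_real_inter {0} (measurableSet_coord_Icc 0 a b)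
      (measurableSet_coord_Icc 1 0 d)
      (fun x y h hx => by
        have := h 0 (by simp)
        simp only [Set.mem_ofPred_eq] at hx ⊢
        rwa [← this])
      (fun x y h hx => by
        have := h 1 (by simp)
        simp only [Set.mem_ofPred_eq] at hx ⊢
        rwa [← this])]
    have h1 := unif_real_coord_Icc_le (n := 2) 0 hab
    have h2 := unif_real_coord_Icc_le (n := 2) 1 hd
    rw [sub_zero] at h2
    exact mul_le_mul h1 h2 measureReal_nonneg (by linarith)
  have hcover : noSale P (Finset.univ : Finset (Fin 2))
      ≤ (unif 2).real (B 0 (c / 3) c ∪ (B (c / 3) (2 * c / 3) (2 * c / 3)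
        ∪ B (2 * c / 3) c (c / 3))) := by
    rw [noSale, unif_real_congr (B := lowerPart (sizePrices P) Finset.univ ∅ ∩ cube 2)
      fun x hx => ⟨fun h => ⟨h, hx⟩, fun h => h.1⟩]
    refine unif_real_mono fun x hx => ?_
    have hx1 := (mem_lowerPart_empty h0).1 hx.1 Finset.univ le_rfl
    have hx2 := mem_cube.1 hx.2
    simp only [Fin.sum_univ_two, Finset.card_univ, Fintype.card_fin, ← h12] at hx1
    have h3 := (hx2 0).1
    have h4 := (hx2 1).1
    rcases le_total (x 0) (c / 3) with h | h
    · exact Or.inl ⟨⟨h3, h⟩, ⟨h4, by linarith⟩⟩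
    rcases le_total (x 0) (2 * c / 3) with h' | h'
    · exact Or.inr (Or.inl ⟨⟨h, h'⟩, ⟨h4, by linarith⟩⟩)
    · exact Or.inr (Or.inr ⟨⟨h', by linarith⟩, ⟨h4, by linarith⟩⟩)
  have h1 := measureReal_union_le (μ := unif 2) (B 0 (c / 3) c)
    (B (c / 3) (2 * c / 3) (2 * c / 3) ∪ B (2 * c / 3) c (c / 3))
  have h2 := measureReal_union_le (μ := unif 2) (B (c / 3) (2 * c / 3) (2 * c / 3))
    (B (2 * c / 3) c (c / 3))
  have h3 := hB 0 (c / 3) c (by linarith) (by linarith)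
  have h4 := hB (c / 3) (2 * c / 3) (2 * c / 3) (by linarith) (by linarith)
  have h5 := hB (2 * c / 3) c (c / 3) (by linarith) (by linarith)
  -- `2 / 3 * (2 / 3) ^ 2 = 8 / 27 < 1 / 3`
  have h6 : c * c ≤ 2 / 3 * (2 / 3) := mul_self_le_mul_self hpos.le hle
  nlinarith

lemma le_noSale_singleton {P : ℕ → ℝ} (h0 : P 0 = 0) (hpos : 0 ≤ P 1) (h1 : P 1 ≤ 1) (i : Fin n) :
    P 1 ≤ noSale P {i} := by
  have h2 : (unif n).real {x | x i ∈ Set.Icc 0 (P 1)} = P 1 := by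
    rw [unif_real_coord i measurableSet_Icc,
      Set.inter_eq_left.2 (Set.Icc_subset_Icc_right h1)]
    simp [hpos]
  rw [← h2]
  refine unif_real_mono fun x hx => (mem_lowerPart_empty h0).2 fun K hK => ?_
  rcases Finset.subset_singleton_iff.1 hK with rfl | rfl
  · simp [h0]
  · simpa using hx.2

/-- A nondegenerate optimal schedule sells all bundles, or all but those with `n - 1` items. In the
second case, a schedule that is critical with respect to all bundles would have at least the same
price for the bundles with `n - 1` items, hence a larger one for the grand bundle, but the
probability of no sale is the same. -/
lemma isSJA_of_not_isDegenerate (hn : 1 ≤ n) {P : ℕ → ℝ} (hP : IsConcaveSeq n P)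
    (hnorm : IsNormalized (sizePrices P : Prices n))
    (hopt : IsOptimal (sizePrices P : Prices n)) (hdeg : ¬ IsDegenerate (sizePrices P : Prices n)) :
    IsSJA (sizePrices P : Prices n) := by
  have hm := isMonoSeq_of_isNormalized hP hnorm
  have h1 := lt_one_of_isOptimal hn hP hm hopt
  have hpos := hP.one_pos_of_isOptimal hn hopt
  have hcrit := satisfiesCriticalConditions_of_isOptimal hn hP hm hopt
  have hL : ∀ I : Finset (Fin n), ¬ IsLeftTight (sizePrices P) I :=
    fun I ⟨J, K, h, _⟩ => hdeg ⟨J, K, h⟩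
  have hR : ∀ I : Finset (Fin n), ¬ IsRightTight (sizePrices P) I :=
    fun I ⟨J, h⟩ => hdeg ⟨I, J, h⟩
  have hdef : ∀ I : Finset (Fin n), I.Nonempty → 0 < volume (region (sizePrices P) I) →
      deficiency (sizePrices P) I = 0 := fun I hI h => (hcrit I hI).1 (hL I) (hR I) h
  have hinc : ∀ k, k + 1 < n → P k < P (k + 1) := by
    intro k hk
    have h2 := hm (k + 1) hk
    have h3 := lt_of_le_of_ne (hP.concave k hk) fun h => hdeg (isDegenerate_of_eq hk h)
    change P (k + 1) ≤ P (k + 2) at h2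
    linarith
  have hsold : ∀ I : Finset (Fin n), (I.card < n → P I.card < P (I.card + 1)) →
      0 < volume (region (sizePrices P) I) := fun I h =>
    (volume_region_pos_iff _ I).2 (unif_real_optSet_pos hP hm h1 h)
  rcases (show P (n - 1) ≤ P n from hm.le (Nat.sub_le n 1) le_rfl).lt_or_eq with hlast | hlast
  -- all bundles are sold
  · have hall : ∀ I : Finset (Fin n), 0 < volume (region (sizePrices P) I) := by
      refine fun I => hsold I fun hI => ?_
      rcases (show I.card + 1 ≤ n from hI).lt_or_eq with h | h
      · exact hinc _ h
      · rwa [← h, Nat.add_sub_cancel] at hlast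
    have hc : IsCriticalFor (sizePrices P : Prices n) (candidate n n) :=
      ⟨fun I => iff_of_true (hall I) (Or.inl (card_le I)), fun I _ hI => hdef I hI (hall I)⟩
    exact ⟨hP.isSymmSubmodular, hnorm, n,
      ⟨⟨hn, le_rfl, _, hP.isSymmSubmodular, hnorm, hc⟩, fun l hl => hl.2.1⟩, hc⟩
  -- exactly the bundles with `n - 1` items are not sold; this is impossible for `n = 1`
  · obtain ⟨m, rfl⟩ : ∃ m, n = m + 2 := by
      refine ⟨n - 2, ?_⟩
      have : n ≠ 1 := by
        rintro rfl
        rw [Nat.sub_self, hP.zero] at hlast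
        exact hpos.ne hlast
      omega
    change P (m + 1) = P (m + 2) at hlast
    have hc : IsCriticalFor (sizePrices P : Prices (m + 2)) (candidate (m + 2) m) := by
      refine ⟨fun I => ⟨fun h => ?_, fun h => hsold I fun hI => ?_⟩, fun I hI hne => ?_⟩
      · by_contra hI
        rw [candidate, Set.mem_ofPred_eq, not_or] at hI
        have hIc := ne_univ_iff_card_lt.1 hI.2
        have h2 := lt_succ_of_volume_pos hP h hIc
        rw [show I.card = m + 1 by omega, hlast] at h2
        exact lt_irrefl _ h2
      · rcases h with h | rfl
        · exact hinc _ (by omega)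
        · simp at hI
      · refine hdef I hne (hsold I fun hIc => ?_)
        rcases hI with h | rfl
        · exact hinc _ (by omega)
        · simp at hIc
    have hnonneg : ∀ I : Finset (Fin (m + 2)), I.Nonempty → 0 ≤ cubeDeficiency (sizePrices P) I :=
      fun I hI => cubeDeficiency_nonneg hP hm h1 hopt hI (hR I)
    rcases Nat.eq_zero_or_pos m with rfl | hm1
    -- two items: the deficiency of single items bounds the price by `2 / 3`, which is too small
    -- for the probability `1 / 3` of no sale
    · exfalso
      have h2 := le_noSale_singleton hP.zero hpos.le h1.le (0 : Fin 2)
      have h3 := noSale_le hP h1 (S := {(0 : Fin 2)}) fun J _ hJ => hnonneg J hJ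
      have h4 := noSale_eq hP h1 (S := (Finset.univ : Finset (Fin 2))) fun J _ hJ => by
        by_cases hJu : J = Finset.univ
        · have := hc.2 J (Or.inr hJu) hJ
          rw [deficiency_eq_cubeDeficiency hP.isSubmodular fun K hK => hm.le_of_subset hK] at this
          rw [this, mul_zero]
        · have h5 := ne_univ_iff_card_lt.1 hJu
          have h6 : J.card = 1 := by have := hJ.card_pos; omega
          rw [unif_real_lowerPart_eq_zero h5 (by rw [h6]; exact hlast.ge), zero_mul]
      norm_num at h3 h4
      have h5 := noSale_two_lt hP.zero hlast hpos (by linarith)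
      linarith
    · refine ⟨hP.isSymmSubmodular, hnorm, m,
        ⟨⟨hm1, by omega, _, hP.isSymmSubmodular, hnorm, hc⟩, ?_⟩, hc⟩
      rintro l ⟨hl1, hln, r, hr, hrnorm, hrc⟩
      -- here `l` is `n - 1` or `n`, so that the competing schedule `R` sells all bundles
      by_contra! hlm
      obtain ⟨R, rfl, hRc⟩ := exists_concaveSeq hr
      have hPs := isCriticalSeq_of_isCriticalFor hn hm1 hP hnorm hc
      have hRs := isCriticalSeq_of_isCriticalFor hn hl1 hRc hrnorm hrc
      have heq : ∀ j ≤ m, R j = P j := fun j hj => hRs.eq_of_le hPs (by omega) hj (by omega)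
      obtain ⟨S, hS⟩ := exists_card_eq (n := m + 2) (k := m + 1) (by omega)
      have hRP : P (m + 1) ≤ R (m + 1) := by
        by_contra! hlt
        have h2 := noSale_lt_noSale (S := S) hRc.zero hP h1.le (fun s hs => by
          rcases hs.lt_or_eq with h | rfl
          · exact (heq s (by omega)).le
          · rw [hS]; exact hlt.le) (by rw [hS]; exact hlt)
          (by simpa [hRc.zero] using hRs.mono.le (Nat.zero_le _) (card_le S))
        have h3 := noSale_le hP h1 (S := S) fun J _ hJ => hnonneg J hJ
        rw [hRs.noSale_eq S (Or.inl (by omega))] at h2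
        linarith
      have hRlt : R (m + 1) < R (m + 2) := by
        have h2 := (hrc.1 S).2 (Or.inl (by omega))
        have h3 := lt_succ_of_volume_pos hRc h2 (by omega)
        rwa [hS] at h3
      have h2 := noSale_lt_noSale (P := P) (Q := R) (S := Finset.univ) hP.zero hRc hRs.lt_one.le
        (fun s hs => by
          rw [Finset.card_univ, Fintype.card_fin] at hs
          rcases Nat.lt_or_ge m s with h | h
          · rcases (show s = m + 1 ∨ s = m + 2 by omega) with rfl | rfl <;> linarith
          · exact (heq s h).ge)
        (by rw [Finset.card_univ, Fintype.card_fin]; linarith)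
        (by simpa [hP.zero] using hm.le (Nat.zero_le _) (card_le Finset.univ))
      rw [hPs.noSale_eq _ (Or.inr rfl), hRs.noSale_eq _ (Or.inr rfl)] at h2
      exact lt_irrefl _ h2

lemma satisfiesCriticalConditions_and_isSJA_or_isDegenerate (hn : 1 ≤ n) {p : Prices n}
    (hnorm : IsNormalized p) (hopt : IsOptimal p) :
    SatisfiesCriticalConditions p ∧ (IsSJA p ∨ IsDegenerate p) := by
  obtain ⟨P, rfl, hP⟩ := exists_concaveSeq hopt.1
  refine ⟨satisfiesCriticalConditions_of_isOptimal hn hP (isMonoSeq_of_isNormalized hP hnorm) hopt,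
    ?_⟩
  by_cases hdeg : IsDegenerate (sizePrices P : Prices n)
  · exact Or.inr hdeg
  · exact Or.inl (isSJA_of_not_isDegenerate hn hP hnorm hopt hdeg)

end Auction

theorem mainTheorem4 (n : ℕ) (hn : 1 ≤ n) :
    -- an optimal auction exists
    (∃ p : Auction.Prices n, Auction.IsNormalized p ∧ Auction.IsOptimal p) ∧
    -- every optimal auction satisfies the critical conditions and is the SJA or degenerate
    (∀ p : Auction.Prices n, Auction.IsNormalized p → Auction.IsOptimal p →
      Auction.SatisfiesCriticalConditions p ∧ (Auction.IsSJA p ∨ Auction.IsDegenerate p)) ∧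
    -- the SJA is optimal, unless another degenerate critical auction is optimal and beats it
    (∀ p : Auction.Prices n, Auction.IsSJA p →
      Auction.IsOptimal p ∨
        ∃ q : Auction.Prices n, Auction.IsNormalized q ∧ Auction.IsOptimal q ∧
          Auction.IsDegenerate q ∧ Auction.SatisfiesCriticalConditions q ∧
          Auction.revenue p < Auction.revenue q) ∧
    -- if no other degenerate auction satisfies the critical conditions, the SJA is optimal
    ((∀ q : Auction.Prices n, Auction.IsSymmSubmodular q → Auction.IsNormalized q →
        Auction.IsDegenerate q → Auction.SatisfiesCriticalConditions q → Auction.IsSJA q) →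
      (∃ p : Auction.Prices n, Auction.IsSJA p) ∧
        ∀ p : Auction.Prices n, Auction.IsSJA p → Auction.IsOptimal p) := by
  obtain ⟨q, hqn, hq⟩ := Auction.exists_isNormalized_isOptimal hn
  obtain ⟨hqc, hqS⟩ := Auction.satisfiesCriticalConditions_and_isSJA_or_isDegenerate hn hqn hq
  refine ⟨⟨q, hqn, hq⟩,
    fun p => Auction.satisfiesCriticalConditions_and_isSJA_or_isDegenerate hn, fun p hp => ?_,
    fun h => ?_⟩
  · rcases hqS with hqS | hqd
    · exact Or.inl (hp.unique hn hqS ▸ hq)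
    · rcases (hq.2 p hp.1).lt_or_eq with hlt | heq
      · exact Or.inr ⟨q, hqn, hq, hqd, hqc, hlt⟩
      · exact Or.inl ⟨hp.1, fun r hr => (hq.2 r hr).trans heq.ge⟩
  · have hqS' : Auction.IsSJA q := hqS.elim id fun hqd => h q hq.1 hqn hqd hqc
    exact ⟨⟨q, hqS'⟩, fun p hp => hp.unique hn hqS' ▸ hq⟩
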